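/- Let $T>0$, $d\in\mathbf N$, and let $\dot W$ be a space-time white noise on $[0,T]\times\mathbf R^d$ over a probability space $(\Omega,\mathcal F,P)$, i.e. a family of jointly Gaussian, mean-zero random variables $\dot W(\xi)=\int\xi\,\dot W\,dx\,dt$, $\xi\in L^2([0,T]\times\mathbf R^d)$, with $\mathbb E[\dot W(\xi)\dot W(\eta)]=\int_{[0,T]\times\mathbf R^d}\xi\eta\,dx\,dt$. Let $W_t(\varphi)=\dot W(1_{[0,t]}\otimes\varphi)\in L^2(\Omega)$, for $t\in[0,T]$ and $\varphi\in L^2(\mathbf R^d)$, be the associated cylindrical Wiener process. Let $\rho:\mathbf R^d\to[0,\infty)$ be $C^\infty$ with compact support, symmetric ($\rho(-x)=\rho(x)$) and with $\int\rho=1$; for $n=1,2,\dots$ put $\rho_n(x)=n^d\rho(nx)$ and $W^{\rho_n}_t(x)=W_t(\rho_n(x-\cdot))$. Then $(W^{\rho_n})$ is a good weak approximation to $W$. That is, there are a filtration $(\mathcal F_t)_{t\in[0,T]}$ and versions of the random variables $W^{\rho_n}_t(x)$ (again denoted $W^{\rho_n}_t(x)$) such that: 1. Each $W^{\rho_n}$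 is a smooth semimartingale: for every $x$, $t\mapsto W^{\rho_n}_t(x)$ is an $(\mathcal F_t)$-semimartingale, and almost surely $W^{\rho_n}_t(x)$ is $C^\infty$ in $x$ for every $t$ and continuous in $t$ for every $x$. 2. For all $n$ and $x$, $(W^{\rho_n}_t(x))_{t\in[0,T]}$ is an $(\mathcal F_t)$-Brownian motion started at $0$ with quadratic variation $\langle W^{\rho_n}(x)\rangle_t=\|\rho\|_{L^2}^2\,n^d\,t$. 3. For all $\varphi\in L^2(\mathbf R^d)$ and $t\in[0,T]$, $$\lim_{n\to\infty}\int_{\mathbf R^d}\varphi(x)\,W^{\rho_n}_t(x)\,dx=W_t(\varphi)\quad\text{in }L^2(\Omega),$$ where the integral over $\mathbf R^d$ is the limit in $L^2(\Omega)$, which exists, of the pathwise Lebesgue integrals over any sequence of bounded measurable sets increasing to $\mathbf R^d$. 4. If moreover $\varphi$ has compact support, then for every $t\in[0,T]$ the integral $\int\varphi(x)W^{\rho_n}_t(x)\,dx$ exists as a Lebesgue integral almost surely for every $n$, and the convergence in 3 holds almost surely. -/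

import Mathlib

open MeasureTheory ProbabilityTheory Filter Topology
open scoped NNReal ENNReal

noncomputable section

namespace CylWiener

/-- The space `ℝ^d` with its Euclidean norm and Lebesgue measure. -/
abbrev Space (d : ℕ) : Type := EuclideanSpace ℝ (Fin d)

/-- The time interval `[0, T]`, as an ordered topological space with least element `0`. -/
abbrev Time (T : ℝ≥0) : Type := Set.Iic T

/-- Lebesgue measure on `[0, T] × ℝ^d`. -/
abbrev spaceTimeMeasure (T : ℝ≥0) (d : ℕ) : Measure (ℝ × Space d) :=
  ((volume : Measure ℝ).restrict (Set.Icc 0 (T : ℝ))).prod (volume : Measure (Space d))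

/-- `L²([0, T] × ℝ^d)`. -/
abbrev SpaceTimeL2 (T : ℝ≥0) (d : ℕ) : Type := Lp ℝ 2 (spaceTimeMeasure T d)

/-- `L²(ℝ^d)`. -/
abbrev SpaceL2 (d : ℕ) : Type := Lp ℝ 2 (volume : Measure (Space d))

/-! ### White noise and the cylindrical Wiener process -/

/-- A space-time white noise on `[0, T] × ℝ^d`: `Wdot ξ` is the random variable
`∫ ξ(t, x) Ẇ(t, x) dx dt`. -/
structure IsSpaceTimeWhiteNoise {Ω : Type*} [MeasurableSpace Ω] (P : Measure Ω) {T : ℝ≥0} {d : ℕ}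
    (Wdot : SpaceTimeL2 T d → Lp ℝ 2 P) : Prop where
  gaussian : IsGaussianProcess (fun ξ ω => Wdot ξ ω) P
  mean_zero : ∀ ξ, ∫ ω, Wdot ξ ω ∂P = 0
  covariance : ∀ ξ η, ∫ ω, Wdot ξ ω * Wdot η ω ∂P
    = ∫ p, ξ p * η p ∂(spaceTimeMeasure T d)

theorem memLp_indicatorTensor {T : ℝ≥0} {d : ℕ} (t : Time T) (φ : SpaceL2 d) :
    MemLp ((Set.Icc 0 ((t : ℝ≥0) : ℝ) ×ˢ Set.univ).indicator fun p : ℝ × Space d => φ p.2) 2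
      (spaceTimeMeasure T d) :=
  ((Lp.memLp φ).comp_snd _).indicator (measurableSet_Icc.prod MeasurableSet.univ)

/-- The function `(s, x) ↦ 1_{[0, t]}(s) φ(x)` as an element of `L²([0, T] × ℝ^d)`. -/
def indicatorTensor {T : ℝ≥0} {d : ℕ} (t : Time T) (φ : SpaceL2 d) : SpaceTimeL2 T d :=
  (memLp_indicatorTensor t φ).toLp _

/-- The cylindrical Wiener process `W_t : L²(ℝ^d) → L²(Ω)` associated to a white noise. -/
def cylindricalWiener {Ω : Type*} [MeasurableSpace Ω] {P : Measure Ω} {T : ℝ≥0} {d : ℕ}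
    (Wdot : SpaceTimeL2 T d → Lp ℝ 2 P) (t : Time T) (φ : SpaceL2 d) : Lp ℝ 2 P :=
  Wdot (indicatorTensor t φ)

/-! ### Semimartingales, Brownian motion, quadratic variation -/

/-- Right-continuous with left limits. -/
def IsCadlag {T : ℝ≥0} (f : Time T → ℝ) : Prop :=
  ∀ t, ContinuousWithinAt f (Set.Ioi t) t ∧ ∃ l, Tendsto f (𝓝[<] t) (𝓝 l)

/-- Local martingales with almost surely càdlàg paths. -/
def IsLocalMartingale {Ω : Type*} {mΩ : MeasurableSpace Ω} (P : Measure Ω) {T : ℝ≥0}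
    (ℱ : Filtration (Time T) mΩ) (M : Time T → Ω → ℝ) : Prop :=
  Locally (fun Y => Martingale Y ℱ P ∧ ∀ᵐ ω ∂P, IsCadlag fun t => Y t ω) ℱ M P

/-- Real semimartingales on `[0, T]`: sums of a local martingale and an adapted càdlàg process of
finite variation. -/
def IsSemimartingale {Ω : Type*} {mΩ : MeasurableSpace Ω} (P : Measure Ω) {T : ℝ≥0}
    (ℱ : Filtration (Time T) mΩ) (X : Time T → Ω → ℝ) : Prop :=
  StronglyAdapted ℱ X ∧
  ∃ M A : Time T → Ω → ℝ,
    IsLocalMartingale P ℱ M ∧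
    StronglyAdapted ℱ A ∧
    (∀ᵐ ω ∂P, IsCadlag (fun t => A t ω) ∧ BoundedVariationOn (fun t => A t ω) Set.univ) ∧
    ∀ᵐ ω ∂P, ∀ t, X t ω = M t ω + A t ω

/-- A random field `S(t, x)` that is a semimartingale in `t` for each `x`, for one and the same
filtration, and that is almost surely `C^∞` in `x` and continuous in `t`. -/
structure IsSmoothSemimartingale {Ω : Type*} {mΩ : MeasurableSpace Ω} (P : Measure Ω) {T : ℝ≥0}
    {d : ℕ} (ℱ : Filtration (Time T) mΩ) (S : Time T → Space d → Ω → ℝ) : Prop where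
  semimartingale : ∀ x, IsSemimartingale P ℱ fun t => S t x
  smooth : ∀ᵐ ω ∂P, (∀ t, ContDiff ℝ (⊤ : ℕ∞) fun x => S t x ω) ∧ ∀ x, Continuous fun t => S t x ω

/-- Brownian motion on `[0, T]` relative to the filtration `ℱ`, with variance `c` per unit of
time. -/
structure IsBrownianMotion {Ω : Type*} {mΩ : MeasurableSpace Ω} (P : Measure Ω) {T : ℝ≥0}
    (ℱ : Filtration (Time T) mΩ) (c : ℝ≥0) (B : Time T → Ω → ℝ) : Prop where
  adapted : StronglyAdapted ℱ B
  start_zero : ∀ᵐ ω ∂P, B ⊥ ω = 0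
  continuous_paths : ∀ᵐ ω ∂P, Continuous fun t => B t ω
  law_increment : ∀ s t, s ≤ t →
    HasLaw (fun ω => B t ω - B s ω) (gaussianReal 0 (c * ((t : ℝ≥0) - (s : ℝ≥0)))) P
  indep_increment : ∀ s t, s ≤ t →
    Indep (MeasurableSpace.comap (fun ω => B t ω - B s ω) inferInstance) (ℱ s) P

/-- `⟨B⟩ = A`: for every `t` and all sequences of partitions `0 = π k 0 ≤ … ≤ π k (N k) = t` with
mesh tending to `0`, the sums of squared increments tend to `A t` in probability. -/
def HasQuadraticVariation {Ω : Type*} [MeasurableSpace Ω] (P : Measure Ω) {T : ℝ≥0}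
    (B A : Time T → Ω → ℝ) : Prop :=
  ∀ (t : Time T) (N : ℕ → ℕ) (π : ℕ → ℕ → Time T),
    (∀ k, Monotone (π k)) → (∀ k, π k 0 = ⊥) → (∀ k, π k (N k) = t) →
    (∀ ε : ℝ, 0 < ε → ∀ᶠ k in atTop, ∀ i < N k, dist (π k (i + 1)) (π k i) ≤ ε) →
    TendstoInMeasure P
      (fun k ω => ∑ i ∈ Finset.range (N k), (B (π k (i + 1)) ω - B (π k i) ω) ^ 2) atTop (A t)

/-! ### Weak approximations -/

/-- `I = ∫ φ(x) Y(x) dx` in `L²(Ω)`. For `φ ∈ L²(ℝ^d)` the integral need not converge absolutely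
for fixed `ω`; it is the limit in `L²(Ω)` of the `ω`-wise Lebesgue integrals over bounded sets
`A k ↑ ℝ^d`, the same for every such exhaustion. -/
def IsSpatialIntegral {Ω : Type*} [MeasurableSpace Ω] (P : Measure Ω) {d : ℕ}
    (φ : Space d → ℝ) (Y : Space d → Ω → ℝ) (I : Ω → ℝ) : Prop :=
  ∀ A : ℕ → Set (Space d), Monotone A → (∀ k, MeasurableSet (A k)) →
    (∀ k, Bornology.IsBounded (A k)) → (⋃ k, A k) = Set.univ →
    (∀ k, ∀ᵐ ω ∂P, IntegrableOn (fun x => φ x * Y x ω) (A k)) ∧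
    (∀ k, MemLp (fun ω => ∫ x in A k, φ x * Y x ω) 2 P) ∧
    Tendsto (fun k => eLpNorm (fun ω => (∫ x in A k, φ x * Y x ω) - I ω) 2 P) atTop (𝓝 0)

/-- The sequence of smooth semimartingales `X n` is a weak approximation to `W`:
`∫ φ(x) X n t x dx → W_t(φ)` in `L²(Ω)` for all `φ ∈ L²(ℝ^d)` and `t ∈ [0, T]`. -/
def IsWeakApproximation {Ω : Type*} {mΩ : MeasurableSpace Ω} {P : Measure Ω} {T : ℝ≥0} {d : ℕ}
    (ℱ : Filtration (Time T) mΩ) (W : Time T → SpaceL2 d → Lp ℝ 2 P)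
    (X : ℕ+ → Time T → Space d → Ω → ℝ) : Prop :=
  (∀ n, IsSmoothSemimartingale P ℱ (X n)) ∧
  ∀ (φ : SpaceL2 d) (t : Time T), ∃ I : ℕ+ → Lp ℝ 2 P,
    (∀ n, IsSpatialIntegral P φ (X n t) (I n)) ∧ Tendsto I atTop (𝓝 (W t φ))

/-- `B` is a Brownian motion with quadratic variation `⟨B⟩_t = c t`. -/
def IsBrownianMotionWithQV {Ω : Type*} {mΩ : MeasurableSpace Ω} (P : Measure Ω) {T : ℝ≥0}
    (ℱ : Filtration (Time T) mΩ) (c : ℝ≥0) (B : Time T → Ω → ℝ) : Prop :=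
  IsBrownianMotion P ℱ c B ∧
  HasQuadraticVariation P B fun t _ => (c : ℝ) * ((t : ℝ≥0) : ℝ)

/-- A weak approximation is good if each `X n · x` is a Brownian motion with quadratic variation
`C n * t`, where `C n` depends on `n` only. -/
def IsGoodWeakApproximation {Ω : Type*} {mΩ : MeasurableSpace Ω} {P : Measure Ω} {T : ℝ≥0}
    {d : ℕ} (ℱ : Filtration (Time T) mΩ) (W : Time T → SpaceL2 d → Lp ℝ 2 P)
    (X : ℕ+ → Time T → Space d → Ω → ℝ) : Prop :=
  IsWeakApproximation ℱ W X ∧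
  ∃ C : ℕ+ → ℝ≥0, ∀ n x, IsBrownianMotionWithQV P ℱ (C n) fun t => X n t x

/-! ### Mollification -/

/-- Nonnegative symmetric smooth kernels with compact support and integral one. -/
structure IsMollifierKernel {d : ℕ} (ρ : Space d → ℝ) : Prop where
  nonneg : ∀ x, 0 ≤ ρ x
  smooth : ContDiff ℝ (⊤ : ℕ∞) ρ
  symm : ∀ x, ρ (-x) = ρ x
  compact_support : HasCompactSupport ρ
  integral_eq_one : ∫ x, ρ x = 1

/-- `ρ_n(x) = n^d ρ(n x)`. -/
def mollifier {d : ℕ} (ρ : Space d → ℝ) (n : ℕ+) (x : Space d) : ℝ :=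
  (n : ℝ) ^ d * ρ ((n : ℝ) • x)

theorem IsMollifierKernel.memLp_translate {d : ℕ} {ρ : Space d → ℝ} (hρ : IsMollifierKernel ρ)
    (n : ℕ+) (x : Space d) : MemLp (fun y => mollifier ρ n (x - y)) 2 volume := by
  have hn : (n : ℝ) ≠ 0 := by exact_mod_cast n.ne_zero
  have hc : Continuous fun y => mollifier ρ n (x - y) := by
    have := hρ.smooth.continuous
    unfold mollifier
    fun_prop
  have h1 : HasCompactSupport (mollifier ρ n) :=
    (hρ.compact_support.comp_homeomorph (Homeomorph.smulOfNeZero (n : ℝ) hn)).mul_left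
  have h2 : HasCompactSupport fun y => mollifier ρ n (x - y) :=
    h1.comp_homeomorph (Homeomorph.subLeft x)
  exact hc.memLp_of_hasCompactSupport h2

/-- `ρ_n(x - ·)` as an element of `L²(ℝ^d)`. -/
def IsMollifierKernel.translate {d : ℕ} {ρ : Space d → ℝ} (hρ : IsMollifierKernel ρ)
    (n : ℕ+) (x : Space d) : SpaceL2 d :=
  (hρ.memLp_translate n x).toLp _

/-- The mollified cylindrical Wiener process `W^{ρ_n}_t(x) = W_t(ρ_n(x - ·))`. -/
def mollifiedWiener {Ω : Type*} [MeasurableSpace Ω] {P : Measure Ω} {T : ℝ≥0} {d : ℕ}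
    (Wdot : SpaceTimeL2 T d → Lp ℝ 2 P) {ρ : Space d → ℝ} (hρ : IsMollifierKernel ρ)
    (n : ℕ+) (t : Time T) (x : Space d) : Lp ℝ 2 P :=
  cylindricalWiener Wdot t (hρ.translate n x)

end CylWiener

end

open CylWiener

/-!
The process `W_t` is not a random vector of `L²(ℝ^d)`, but its composition with a Hilbert–Schmidt
operator `A` is: the series `∑ j, W_t(A b_j) b_j` over a Hilbert basis converges in `L²(Ω)`, and
Gaussian fourth moments with the Kolmogorov criterion give a version `Y` with continuous paths in
`L²(ℝ^d)`. Choose `A` with a range containing all `C^∞` functions with compact support. If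
`A g_x = ρ_n (x - ·)`, then `⟨g_x, Y_t⟩` is a version of `W_t(ρ_n (x - ·))`, continuous in `t` for
every `ω`. Taking for `A` a weighted convolution with a fundamental solution of `∏ (1 + ∂_i)`, one
gets `g_x` by applying a differential operator to `ρ_n`, so that `⟨g_x, Y_t⟩` is a convolution with
a `C^∞` kernel and is smooth in `x`.

For the almost sure convergence, let `φ_n` be the mollifications of a compactly supported `φ`. Since
`𝓕 ρ_n(ξ) = 𝓕 ρ(ξ / n)`, Plancherel bounds `‖φ_n - φ_m‖²` by the increment between `1 / n` and
`1 / m` of one bounded monotone function of the scale. With that function as the time parameter,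
`n ↦ W_t(φ_n)` satisfies the same Kolmogorov criterion, hence is almost surely Cauchy.
-/

namespace CylWiener

/-! ### A Kolmogorov continuity criterion -/

section Kolmogorov

section DyadicChaining

variable {S : Type*} {F : S → ℝ}

/-- The index of the dyadic interval of length `2⁻ᵐ` that contains `F s`. -/
noncomputable def dyadicClass (F : S → ℝ) (m : ℕ) (s : S) : ℤ := ⌊2 ^ m * F s⌋

theorem dyadicClass_succ_div_two (F : S → ℝ) (m : ℕ) (s : S) :
    dyadicClass F (m + 1) s / 2 = dyadicClass F m s := by
  refine (Int.floor_div_natCast (2 ^ (m + 1) * F s) 2).symm.trans (congrArg _ ?_)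
  push_cast
  ring

theorem dist_le_of_abs_dyadicClass_sub_le {m : ℕ} {s t : S}
    (h : |dyadicClass F m s - dyadicClass F m t| ≤ 1) : dist (F s) (F t) ≤ 2 * (1 / 2) ^ m := by
  have hclass : |(⌊2 ^ m * F s⌋ : ℝ) - ⌊2 ^ m * F t⌋| ≤ 1 := by
    rw [← Int.cast_sub, ← Int.cast_abs]
    exact (Int.cast_le.2 h).trans_eq Int.cast_one
  have hscaled : |2 ^ m * F s - 2 ^ m * F t| ≤ 2 := by
    rw [abs_le] at hclass ⊢
    constructor <;> linarith [Int.floor_le (2 ^ m * F s), Int.lt_floor_add_one (2 ^ m * F s),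
      Int.floor_le (2 ^ m * F t), Int.lt_floor_add_one (2 ^ m * F t)]
  rw [← mul_sub, abs_mul, abs_of_pos (by positivity), ← Real.dist_eq, mul_comm] at hscaled
  rwa [one_div_pow, mul_one_div, le_div_iff₀ (by positivity)]

theorem abs_dyadicClass_sub_le_of_dist_lt {m : ℕ} {s t : S} (h : dist (F s) (F t) < (1 / 2) ^ m) :
    |dyadicClass F m s - dyadicClass F m t| ≤ 1 := by
  have hscaled : |2 ^ m * F s - 2 ^ m * F t| < 1 := by
    rw [← mul_sub, abs_mul, abs_of_pos (by positivity), ← Real.dist_eq, mul_comm]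
    rwa [one_div_pow, lt_div_iff₀ (by positivity)] at h
  rw [abs_lt] at hscaled
  have h1 : dyadicClass F m s < dyadicClass F m t + 2 := by
    rw [dyadicClass, dyadicClass, Int.floor_lt]
    push_cast
    linarith [Int.lt_floor_add_one (2 ^ m * F t)]
  have h2 : dyadicClass F m t < dyadicClass F m s + 2 := by
    rw [dyadicClass, dyadicClass, Int.floor_lt]
    push_cast
    linarith [Int.lt_floor_add_one (2 ^ m * F s)]
  rw [abs_le]
  constructor <;> linarith

/-- The dyadic classes at level `m` that a function bounded by the integer `R` can reach. -/
noncomputable def dyadicClasses (R : ℕ) (m : ℕ) : Finset ℤ :=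
  Finset.Ico (-(R * 2 ^ m)) (R * 2 ^ m + 1)

theorem dyadicClass_mem_dyadicClasses {R : ℕ} (hF : ∀ s, |F s| ≤ R) (m : ℕ) (s : S) :
    dyadicClass F m s ∈ dyadicClasses R m := by
  obtain ⟨hl, hu⟩ := abs_le.1 (hF s)
  have hpos : (0 : ℝ) < 2 ^ m := by positivity
  refine Finset.mem_Ico.2 ⟨Int.le_floor.2 ?_, Int.floor_lt.2 ?_⟩ <;> push_cast <;> nlinarith

theorem card_dyadicClasses_le (R m : ℕ) : (dyadicClasses R m).card ≤ (2 * R + 1) * 2 ^ m := by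
  have hone : 1 ≤ 2 ^ m := Nat.one_le_two_pow
  have hcard : ((dyadicClasses R m).card : ℤ) = 2 * (R * 2 ^ m) + 1 := by
    rw [dyadicClasses, Int.card_Ico, Int.toNat_of_nonneg]
    · ring
    · linarith [show (0 : ℤ) ≤ R * 2 ^ m by positivity]
  zify at hone ⊢
  rw [hcard]
  linarith

variable [Nonempty S]

/-- The chosen representative of the dyadic class of `s` at level `m`. -/
noncomputable def dyadicApprox (F : S → ℝ) (m : ℕ) (s : S) : S :=
  Function.invFun (dyadicClass F m) (dyadicClass F m s)

@[simp]
theorem dyadicClass_dyadicApprox (F : S → ℝ) (m : ℕ) (s : S) :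
    dyadicClass F m (dyadicApprox F m s) = dyadicClass F m s :=
  Function.invFun_eq ⟨s, rfl⟩

open Classical in
/-- The pairs of representatives whose increments control the chaining argument at level `m`: a
class at level `m + 1` with its parent, and two neighbouring classes at level `m`. The last filter
discards the pairs built from classes that `F` does not reach. -/
noncomputable def chainingPairs (F : S → ℝ) (R m : ℕ) : Finset (S × S) :=
  ((dyadicClasses R (m + 1)).image (fun i =>
      (Function.invFun (dyadicClass F m) (i / 2), Function.invFun (dyadicClass F (m + 1)) i)) ∪
    (dyadicClasses R m).image (fun i =>
      (Function.invFun (dyadicClass F m) i, Function.invFun (dyadicClass F m) (i + 1)))).filter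
    fun a => dist (F a.1) (F a.2) ≤ 2 * (1 / 2) ^ m

theorem dist_le_of_mem_chainingPairs {R m : ℕ} {a : S × S} (ha : a ∈ chainingPairs F R m) :
    dist (F a.1) (F a.2) ≤ 2 * (1 / 2) ^ m :=
  (Finset.mem_filter.1 ha).2

theorem card_chainingPairs_le (F : S → ℝ) (R m : ℕ) :
    (chainingPairs F R m).card ≤ 3 * (2 * R + 1) * 2 ^ m := by
  classical
  calc (chainingPairs F R m).card
      ≤ (dyadicClasses R (m + 1)).card + (dyadicClasses R m).card :=
        (Finset.card_filter_le _ _).trans ((Finset.card_union_le _ _).trans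
          (add_le_add Finset.card_image_le Finset.card_image_le))
    _ ≤ (2 * R + 1) * 2 ^ (m + 1) + (2 * R + 1) * 2 ^ m :=
        add_le_add (card_dyadicClasses_le R (m + 1)) (card_dyadicClasses_le R m)
    _ = 3 * (2 * R + 1) * 2 ^ m := by ring

theorem dyadicApprox_succ_mem_chainingPairs {R : ℕ} (hF : ∀ s, |F s| ≤ R) (m : ℕ) (s : S) :
    (dyadicApprox F m s, dyadicApprox F (m + 1) s) ∈ chainingPairs F R m := by
  classical
  refine Finset.mem_filter.2 ⟨Finset.mem_union_left _ (Finset.mem_image.2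
    ⟨_, dyadicClass_mem_dyadicClasses hF (m + 1) s, ?_⟩), ?_⟩
  · rw [dyadicClass_succ_div_two]
    rfl
  · have hclass : dyadicClass F m (dyadicApprox F (m + 1) s) = dyadicClass F m s := by
      rw [← dyadicClass_succ_div_two, dyadicClass_dyadicApprox, dyadicClass_succ_div_two]
    exact dist_le_of_abs_dyadicClass_sub_le (by simp [hclass])

theorem dyadicApprox_mem_chainingPairs_of_eq_add_one {R : ℕ} (hF : ∀ s, |F s| ≤ R) {m : ℕ} {s t : S}
    (h : dyadicClass F m t = dyadicClass F m s + 1) :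
    (dyadicApprox F m s, dyadicApprox F m t) ∈ chainingPairs F R m := by
  classical
  refine Finset.mem_filter.2 ⟨Finset.mem_union_right _ (Finset.mem_image.2
    ⟨_, dyadicClass_mem_dyadicClasses hF m s, ?_⟩), ?_⟩
  · rw [← h]
    rfl
  · exact dist_le_of_abs_dyadicClass_sub_le (by simp [h])

theorem dyadicApprox_eq_or_mem_chainingPairs {R : ℕ} (hF : ∀ s, |F s| ≤ R) {m : ℕ} {s t : S}
    (h : dist (F s) (F t) < (1 / 2) ^ m) :
    dyadicApprox F m s = dyadicApprox F m t ∨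
      (dyadicApprox F m s, dyadicApprox F m t) ∈ chainingPairs F R m ∨
      (dyadicApprox F m t, dyadicApprox F m s) ∈ chainingPairs F R m := by
  obtain ⟨hl, hu⟩ := abs_le.1 (abs_dyadicClass_sub_le_of_dist_lt h)
  rcases lt_trichotomy (dyadicClass F m s) (dyadicClass F m t) with hlt | heq | hgt
  · exact .inr (.inl (dyadicApprox_mem_chainingPairs_of_eq_add_one hF (by omega)))
  · exact .inl (by rw [dyadicApprox, dyadicApprox, heq])
  · exact .inr (.inr (dyadicApprox_mem_chainingPairs_of_eq_add_one hF (by omega)))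

end DyadicChaining

variable {S E : Type*} {F : S → ℝ}

theorem exists_tendsto_uniformContinuous_of_edist_le [MetricSpace E] [CompleteSpace E]
    {z : ℕ → S → E} {ε : ℕ → ℝ≥0∞} (hε : ∑' m, ε m ≠ ∞)
    (hsucc : ∀ m s, edist (z m s) (z (m + 1) s) ≤ ε m)
    (hnear : ∀ m s t, dist (F s) (F t) < (1 / 2) ^ m → edist (z m s) (z m t) ≤ ε m) :
    ∃ y : S → E, (∀ s, Tendsto (fun m => z m s) atTop (𝓝 (y s))) ∧
      ∀ η > 0, ∃ δ > 0, ∀ s t, dist (F s) (F t) < δ → dist (y s) (y t) < η := by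
  choose y hy using fun s =>
    cauchySeq_tendsto_of_complete (cauchySeq_of_edist_le_of_tsum_ne_top ε (fun m => hsucc m s) hε)
  refine ⟨y, hy, fun η hη => ?_⟩
  have htail : Tendsto (fun m => 3 * ∑' k, ε (k + m)) atTop (𝓝 0) := by
    simpa using ENNReal.Tendsto.const_mul (ENNReal.tendsto_sum_nat_add ε hε)
      (.inr (ENNReal.ofNat_ne_top (n := 3)))
  obtain ⟨m, hm⟩ := (htail.eventually (gt_mem_nhds (ENNReal.ofReal_pos.2 hη))).exists
  refine ⟨(1 / 2) ^ m, by positivity, fun s t hst => ?_⟩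
  have hlim : ∀ r, edist (z m r) (y r) ≤ ∑' k, ε (k + m) := fun r => by
    simpa only [add_comm] using
      edist_le_tsum_of_edist_le_of_tendsto ε (fun k => hsucc k r) (hy r) m
  have hmid : edist (z m s) (z m t) ≤ ∑' k, ε (k + m) :=
    (hnear m s t hst).trans (by simpa using ENNReal.le_tsum (f := fun k => ε (k + m)) 0)
  rw [← ENNReal.ofReal_lt_ofReal_iff hη, ← edist_dist]
  calc edist (y s) (y t)
      ≤ edist (y s) (z m s) + edist (z m s) (z m t) + edist (z m t) (y t) := edist_triangle4 ..
    _ ≤ ∑' k, ε (k + m) + ∑' k, ε (k + m) + ∑' k, ε (k + m) := by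
        rw [edist_comm (y s)]
        exact add_le_add (add_le_add (hlim s) hmid) (hlim t)
    _ = 3 * ∑' k, ε (k + m) := by ring
    _ < ENNReal.ofReal η := hm

variable {Ω : Type*} {mΩ : MeasurableSpace Ω} {P : Measure Ω}

theorem ae_tsum_ne_top_of_lintegral_le_geometric {f : ℕ → Ω → ℝ≥0∞} (hf : ∀ m, Measurable (f m))
    {C r : ℝ≥0∞} (hC : C ≠ ∞) (hr : r < 1) (h : ∀ m, ∫⁻ ω, f m ω ∂P ≤ C * r ^ m) :
    ∀ᵐ ω ∂P, ∑' m, f m ω ≠ ∞ := by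
  suffices hfin : ∫⁻ ω, ∑' m, f m ω ∂P ≠ ∞ from
    (ae_lt_top (Measurable.tsum hf) hfin).mono fun ω hω => hω.ne
  rw [lintegral_tsum fun m => (hf m).aemeasurable]
  refine ne_top_of_le_ne_top ?_ (ENNReal.tsum_le_tsum h)
  rw [ENNReal.tsum_mul_left, ENNReal.tsum_geometric]
  exact ENNReal.mul_ne_top hC (ENNReal.inv_ne_top.2 (tsub_pos_of_lt hr).ne')

theorem lintegral_rpow_one_div_le [IsProbabilityMeasure P] {f : Ω → ℝ≥0∞} (hf : Measurable f)
    {p : ℝ} (hp : 1 ≤ p) : ∫⁻ ω, f ω ^ (1 / p) ∂P ≤ (∫⁻ ω, f ω ∂P) ^ (1 / p) := by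
  have hp0 : p ≠ 0 := by positivity
  have h := eLpNorm'_le_eLpNorm'_of_exponent_le (μ := P) zero_lt_one hp
    (hf.pow_const (1 / p)).aestronglyMeasurable
  simpa [eLpNorm', ← ENNReal.rpow_mul, hp0] using h

section Chaining

variable [MetricSpace E] {Z : S → Ω → E} {p q : ℝ} {M : ℝ≥0}

theorem measurable_edist_apply (hZ : ∀ s, StronglyMeasurable (Z s)) (s t : S) :
    Measurable fun ω => edist (Z s ω) (Z t ω) :=
  (continuous_edist.comp_stronglyMeasurable ((hZ s).prodMk (hZ t))).measurable

theorem lintegral_edist_rpow_le_of_dist_le (hq : 1 < q)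
    (hmom : ∀ s t, ∫⁻ ω, edist (Z s ω) (Z t ω) ^ p ∂P ≤ M * edist (F s) (F t) ^ q) {m : ℕ} {s t : S}
    (h : dist (F s) (F t) ≤ 2 * (1 / 2) ^ m) :
    ∫⁻ ω, edist (Z s ω) (Z t ω) ^ p ∂P ≤ M * 2 ^ q * (2⁻¹ ^ q) ^ m := by
  have hedist : edist (F s) (F t) ≤ 2 * 2⁻¹ ^ m := by
    rw [edist_dist]
    refine (ENNReal.ofReal_le_ofReal h).trans_eq ?_
    rw [ENNReal.ofReal_mul zero_le_two, ENNReal.ofReal_pow (by norm_num), one_div,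
      ENNReal.ofReal_inv_of_pos two_pos, ENNReal.ofReal_ofNat]
  calc ∫⁻ ω, edist (Z s ω) (Z t ω) ^ p ∂P ≤ M * edist (F s) (F t) ^ q := hmom s t
    _ ≤ M * (2 * 2⁻¹ ^ m) ^ q := by gcongr
    _ = M * 2 ^ q * (2⁻¹ ^ q) ^ m := by
        rw [ENNReal.mul_rpow_of_nonneg _ _ (by positivity), mul_assoc, ← ENNReal.rpow_natCast,
          ← ENNReal.rpow_natCast, ← ENNReal.rpow_mul, ← ENNReal.rpow_mul, mul_comm (m : ℝ)]

variable [Nonempty S]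

/-- The `ℓᵖ` size of the increments of `Z` over the chaining pairs at level `m`. -/
noncomputable def chainingOscillation (F : S → ℝ) (R : ℕ) (Z : S → Ω → E) (p : ℝ) (m : ℕ) (ω : Ω) :
    ℝ≥0∞ :=
  (∑ a ∈ chainingPairs F R m, edist (Z a.1 ω) (Z a.2 ω) ^ p) ^ (1 / p)

theorem measurable_chainingOscillation (hZ : ∀ s, StronglyMeasurable (Z s)) (R m : ℕ) :
    Measurable (chainingOscillation F R Z p m) :=
  (Finset.measurable_fun_sum _ fun _ _ =>
    (measurable_edist_apply hZ _ _).pow_const p).pow_const (1 / p)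

theorem edist_le_chainingOscillation (hp : 1 ≤ p) {R m : ℕ} {s t : S}
    (h : (s, t) ∈ chainingPairs F R m) (ω : Ω) :
    edist (Z s ω) (Z t ω) ≤ chainingOscillation F R Z p m ω := by
  have hp0 : p ≠ 0 := by positivity
  calc edist (Z s ω) (Z t ω) = (edist (Z s ω) (Z t ω) ^ p) ^ (1 / p) := by
        rw [← ENNReal.rpow_mul, mul_one_div_cancel hp0, ENNReal.rpow_one]
    _ ≤ chainingOscillation F R Z p m ω := by
        refine ENNReal.rpow_le_rpow ?_ (by positivity)
        exact Finset.single_le_sum (f := fun a : S × S => edist (Z a.1 ω) (Z a.2 ω) ^ p)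
          (fun _ _ => zero_le) h

theorem lintegral_chainingOscillation_le [IsProbabilityMeasure P]
    (hZ : ∀ s, StronglyMeasurable (Z s)) (hp : 1 ≤ p) (hq : 1 < q)
    (hmom : ∀ s t, ∫⁻ ω, edist (Z s ω) (Z t ω) ^ p ∂P ≤ M * edist (F s) (F t) ^ q) (R m : ℕ) :
    ∫⁻ ω, chainingOscillation F R Z p m ω ∂P
      ≤ ((3 * (2 * R + 1) : ℕ) * (M * 2 ^ q)) ^ (1 / p) * ((2 * 2⁻¹ ^ q) ^ (1 / p)) ^ m := by
  have hmeas : ∀ s t, Measurable fun ω => edist (Z s ω) (Z t ω) ^ p := fun s t =>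
    (measurable_edist_apply hZ s t).pow_const p
  calc ∫⁻ ω, chainingOscillation F R Z p m ω ∂P
      ≤ (∫⁻ ω, ∑ a ∈ chainingPairs F R m, edist (Z a.1 ω) (Z a.2 ω) ^ p ∂P) ^ (1 / p) :=
        lintegral_rpow_one_div_le (Finset.measurable_fun_sum _ fun _ _ => hmeas _ _) hp
    _ = (∑ a ∈ chainingPairs F R m, ∫⁻ ω, edist (Z a.1 ω) (Z a.2 ω) ^ p ∂P) ^ (1 / p) := by
        rw [lintegral_finsetSum _ fun _ _ => hmeas _ _]
    _ ≤ ((3 * (2 * R + 1) * 2 ^ m : ℕ) * (M * 2 ^ q * (2⁻¹ ^ q) ^ m)) ^ (1 / p) := by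
        gcongr
        refine (Finset.sum_le_card_nsmul _ _ _ fun a ha =>
          lintegral_edist_rpow_le_of_dist_le hq hmom (dist_le_of_mem_chainingPairs ha)).trans ?_
        rw [nsmul_eq_mul]
        gcongr
        exact card_chainingPairs_le F R m
    _ = _ := by
        have hroot : ∀ a : ℝ≥0∞, (a ^ (1 / p)) ^ m = (a ^ m) ^ (1 / p) := fun a => by
          rw [← ENNReal.rpow_natCast, ← ENNReal.rpow_mul, mul_comm, ENNReal.rpow_mul,
            ENNReal.rpow_natCast]
        rw [hroot, ← ENNReal.mul_rpow_of_nonneg _ _ (by positivity), mul_pow]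
        push_cast
        ring_nf

theorem ae_tsum_chainingOscillation_ne_top [IsProbabilityMeasure P]
    (hZ : ∀ s, StronglyMeasurable (Z s)) (hp : 1 ≤ p) (hq : 1 < q)
    (hmom : ∀ s t, ∫⁻ ω, edist (Z s ω) (Z t ω) ^ p ∂P ≤ M * edist (F s) (F t) ^ q) (R : ℕ) :
    ∀ᵐ ω ∂P, ∑' m, chainingOscillation F R Z p m ω ≠ ∞ := by
  refine ae_tsum_ne_top_of_lintegral_le_geometric (measurable_chainingOscillation hZ R) ?_ ?_
    (lintegral_chainingOscillation_le hZ hp hq hmom R)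
  · have h2q : (2 : ℝ≥0∞) ^ q ≠ ∞ := ENNReal.rpow_ne_top_of_nonneg (by positivity) (by simp)
    exact ENNReal.rpow_ne_top_of_nonneg (by positivity) (ENNReal.mul_ne_top
      (ENNReal.natCast_ne_top _) (ENNReal.mul_ne_top ENNReal.coe_ne_top h2q))
  · have hq' : (2⁻¹ : ℝ≥0∞) ^ q < 2⁻¹ := by
      simpa using ENNReal.rpow_lt_rpow_of_exponent_gt (x := 2⁻¹) (by simp)
        (ENNReal.inv_lt_one.2 ENNReal.one_lt_two) hq
    have h2 : 2 * (2⁻¹ : ℝ≥0∞) ^ q < 1 := by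
      calc 2 * (2⁻¹ : ℝ≥0∞) ^ q < 2 * 2⁻¹ :=
          (ENNReal.mul_lt_mul_iff_right (by simp) (by simp)).2 hq'
        _ = 1 := ENNReal.mul_inv_cancel (by simp) (by simp)
    exact ENNReal.rpow_lt_one h2 (by positivity)

theorem ae_tendsto_dyadicApprox (hZ : ∀ s, StronglyMeasurable (Z s)) (hp : 1 ≤ p) (hq : 1 < q)
    (hmom : ∀ s t, ∫⁻ ω, edist (Z s ω) (Z t ω) ^ p ∂P ≤ M * edist (F s) (F t) ^ q) (s : S) :
    ∀ᵐ ω ∂P, Tendsto (fun m => Z (dyadicApprox F m s) ω) atTop (𝓝 (Z s ω)) := by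
  have hsum : ∀ᵐ ω ∂P, ∑' m, edist (Z (dyadicApprox F m s) ω) (Z s ω) ^ p ≠ ∞ := by
    refine ae_tsum_ne_top_of_lintegral_le_geometric
      (fun m => (measurable_edist_apply hZ _ _).pow_const p) (C := M * 2 ^ q) (r := 2⁻¹ ^ q) ?_ ?_
      fun m => lintegral_edist_rpow_le_of_dist_le hq hmom
        (dist_le_of_abs_dyadicClass_sub_le (by simp))
    · exact ENNReal.mul_ne_top ENNReal.coe_ne_top
        (ENNReal.rpow_ne_top_of_nonneg (by positivity) (by simp))
    · exact ENNReal.rpow_lt_one (ENNReal.inv_lt_one.2 ENNReal.one_lt_two) (by positivity)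
  filter_upwards [hsum] with ω hω
  rw [tendsto_iff_edist_tendsto_0]
  have hroot := (ENNReal.continuous_rpow_const (y := 1 / p)).tendsto 0 |>.comp
    (ENNReal.tendsto_atTop_zero_of_tsum_ne_top hω)
  rw [ENNReal.zero_rpow_of_pos (by positivity)] at hroot
  refine hroot.congr fun m => ?_
  rw [Function.comp_apply, ← ENNReal.rpow_mul, mul_one_div_cancel (by positivity), ENNReal.rpow_one]

end Chaining

theorem exists_modification_uniformContinuous [Nonempty S] [MetricSpace E] [CompleteSpace E]
    [IsProbabilityMeasure P] {R : ℕ} (hF : ∀ s, |F s| ≤ R) {Z : S → Ω → E}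
    (hZ : ∀ s, StronglyMeasurable (Z s)) {p q : ℝ} (hp : 1 ≤ p) (hq : 1 < q) {M : ℝ≥0}
    (hmom : ∀ s t, ∫⁻ ω, edist (Z s ω) (Z t ω) ^ p ∂P ≤ M * edist (F s) (F t) ^ q) :
    ∃ Y : S → Ω → E, (∀ s, StronglyMeasurable (Y s)) ∧ (∀ s, Y s =ᵐ[P] Z s) ∧
      ∀ ω, ∀ ε > 0, ∃ δ > 0, ∀ s t, dist (F s) (F t) < δ → dist (Y s ω) (Y t ω) < ε := by
  classical
  let good : Set Ω := {ω | ∑' m, chainingOscillation F R Z p m ω ≠ ∞}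
  have hgood_meas : MeasurableSet good :=
    (measurableSet_eq_fun (Measurable.tsum (measurable_chainingOscillation hZ R))
      measurable_const).compl
  have hgood : ∀ᵐ ω ∂P, ω ∈ good := ae_tsum_chainingOscillation_ne_top hZ hp hq hmom R
  obtain ⟨ω₀⟩ : Nonempty Ω := nonempty_of_isProbabilityMeasure P
  let U : ℕ → S → Ω → E := fun m s =>
    good.piecewise (Z (dyadicApprox F m s)) fun _ => Z (Classical.arbitrary S) ω₀
  have hU : ∀ ω ∈ good, ∀ m s, U m s ω = Z (dyadicApprox F m s) ω := fun ω hω m s =>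
    Set.piecewise_eq_of_mem _ _ _ hω
  have hlim : ∀ ω, ∃ y : S → E, (∀ s, Tendsto (fun m => U m s ω) atTop (𝓝 (y s))) ∧
      ∀ ε > 0, ∃ δ > 0, ∀ s t, dist (F s) (F t) < δ → dist (y s) (y t) < ε := by
    intro ω
    by_cases hω : ω ∈ good
    · refine exists_tendsto_uniformContinuous_of_edist_le hω (fun m s => ?_) fun m s t hst => ?_
      · rw [hU ω hω, hU ω hω]
        exact edist_le_chainingOscillation hp (dyadicApprox_succ_mem_chainingPairs hF m s) ω
      · rw [hU ω hω, hU ω hω]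
        rcases dyadicApprox_eq_or_mem_chainingPairs hF hst with h | h | h
        · simp [h]
        · exact edist_le_chainingOscillation hp h ω
        · exact edist_comm (Z _ ω) _ ▸ edist_le_chainingOscillation hp h ω
    · refine ⟨fun _ => Z (Classical.arbitrary S) ω₀, fun s => ?_,
        fun ε hε => ⟨1, one_pos, by simp [hε]⟩⟩
      simp only [U, Set.piecewise_eq_of_notMem _ _ _ hω, tendsto_const_nhds]
  choose y hy hy_cont using hlim
  refine ⟨fun s ω => y ω s, fun s => ?_, fun s => ?_, hy_cont⟩
  · exact stronglyMeasurable_of_tendsto atTop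
      (fun m => (hZ (dyadicApprox F m s)).piecewise hgood_meas stronglyMeasurable_const)
      (tendsto_pi_nhds.2 fun ω => hy ω s)
  · filter_upwards [ae_tendsto_dyadicApprox hZ hp hq hmom s, hgood] with ω hω hmem
    exact tendsto_nhds_unique (hy ω s) (hω.congr fun m => (hU ω hmem m s).symm)

end Kolmogorov

/-! ### Gaussian moments -/

theorem deriv_mul_exp_half_sq {p p' : ℝ → ℝ} (v : ℝ) (hp : ∀ t, HasDerivAt p (p' t) t) :
    deriv (fun t => p t * Real.exp (v * t ^ 2 / 2))
      = fun t => (p' t + v * t * p t) * Real.exp (v * t ^ 2 / 2) := by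
  ext t
  have hexp : HasDerivAt (fun t : ℝ => Real.exp (v * t ^ 2 / 2))
      (Real.exp (v * t ^ 2 / 2) * (v * t)) t := by
    have hquad : HasDerivAt (fun t : ℝ => v * t ^ 2 / 2) (v * t) t :=
      (((hasDerivAt_pow 2 t).const_mul v).div_const 2).congr_deriv (by norm_num; ring)
    exact hquad.exp
  refine ((hp t).fun_mul hexp).deriv.trans ?_
  ring

theorem integral_pow_four_gaussianReal (v : ℝ≥0) :
    ∫ x, x ^ 4 ∂(gaussianReal 0 v) = 3 * (v : ℝ) ^ 2 := by
  have hmgf : mgf id (gaussianReal 0 v) = fun t => 1 * Real.exp (v * t ^ 2 / 2) := by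
    simp [mgf_id_gaussianReal]
  have hinterior : (0 : ℝ) ∈ interior (integrableExpSet id (gaussianReal 0 v)) := by simp
  have hmoment := iteratedDeriv_mgf_zero hinterior 4
  have h1 (t : ℝ) : HasDerivAt (fun _ => (1 : ℝ)) 0 t := hasDerivAt_const t 1
  have h2 (t : ℝ) : HasDerivAt (fun t : ℝ => 0 + (v : ℝ) * t * 1) (v : ℝ) t :=
    (((hasDerivAt_id t).const_mul (v : ℝ)).congr_of_eventuallyEq
      (Eventually.of_forall fun x => by simp)).congr_deriv (by simp)
  have h3 (t : ℝ) : HasDerivAt (fun t : ℝ => v + v * t * (0 + v * t * 1)) (2 * v ^ 2 * t) t :=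
    ((((hasDerivAt_pow 2 t).const_mul ((v : ℝ) ^ 2)).const_add (v : ℝ)).congr_of_eventuallyEq
      (Eventually.of_forall fun x => by ring)).congr_deriv (by norm_num; ring)
  have h4 (t : ℝ) : HasDerivAt
      (fun t : ℝ => 2 * v ^ 2 * t + v * t * (v + v * t * (0 + v * t * 1)))
      (3 * v ^ 2 + 3 * v ^ 3 * t ^ 2) t :=
    ((((hasDerivAt_id t).const_mul (3 * (v : ℝ) ^ 2)).add
      ((hasDerivAt_pow 3 t).const_mul ((v : ℝ) ^ 3))).congr_of_eventuallyEq
      (Eventually.of_forall fun x => by simp; ring)).congr_deriv (by norm_num; ring)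
  rw [hmgf, iteratedDeriv_succ', deriv_mul_exp_half_sq _ h1, iteratedDeriv_succ',
    deriv_mul_exp_half_sq _ h2, iteratedDeriv_succ', deriv_mul_exp_half_sq _ h3, iteratedDeriv_one,
    deriv_mul_exp_half_sq _ h4] at hmoment
  simpa using hmoment.symm

section Moments

variable {Ω : Type*} {mΩ : MeasurableSpace Ω} {P : Measure Ω} {Z : Ω → ℝ} {v : ℝ≥0}

theorem memLp_sq_of_hasLaw_gaussianReal (hZ : HasLaw Z (gaussianReal 0 v) P) :
    MemLp (fun ω => Z ω ^ 2) 2 P := by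
  have hint := (memLp_id_gaussianReal (μ := 0) (v := v) 4).integrable_norm_pow (p := 4) (by simp)
  rw [← hZ.map_eq] at hint
  rw [memLp_two_iff_integrable_sq (hZ.aemeasurable.pow_const 2).aestronglyMeasurable]
  refine (hint.comp_aemeasurable hZ.aemeasurable).congr (ae_of_all _ fun ω => ?_)
  simp only [Function.comp_apply, id, Real.norm_eq_abs, Even.pow_abs (by decide : Even 4),
    ← pow_mul]

theorem integral_eq_zero_of_hasLaw_gaussianReal (hZ : HasLaw Z (gaussianReal 0 v) P) :
    ∫ ω, Z ω ∂P = 0 := by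
  rw [hZ.integral_eq, integral_id_gaussianReal]

theorem integral_sq_of_hasLaw_gaussianReal (hZ : HasLaw Z (gaussianReal 0 v) P) :
    ∫ ω, Z ω ^ 2 ∂P = v := by
  rw [← variance_of_integral_eq_zero hZ.aemeasurable (integral_eq_zero_of_hasLaw_gaussianReal hZ),
    hZ.variance_eq, variance_id_gaussianReal]

theorem integral_pow_four_of_hasLaw_gaussianReal (hZ : HasLaw Z (gaussianReal 0 v) P) :
    ∫ ω, Z ω ^ 4 ∂P = 3 * (v : ℝ) ^ 2 := by
  rw [← integral_pow_four_gaussianReal v]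
  exact hZ.integral_comp (f := fun x : ℝ => x ^ 4) (by fun_prop)

theorem lintegral_enorm_pow_four_of_hasLaw_gaussianReal (hZ : HasLaw Z (gaussianReal 0 v) P) :
    ∫⁻ ω, ‖Z ω‖ₑ ^ 4 ∂P = 3 * (v : ℝ≥0∞) ^ 2 := by
  have hint : Integrable (fun ω => Z ω ^ 4) P := by
    simpa only [← pow_mul] using (memLp_sq_of_hasLaw_gaussianReal hZ).integrable_sq
  calc ∫⁻ ω, ‖Z ω‖ₑ ^ 4 ∂P = ∫⁻ ω, ENNReal.ofReal (Z ω ^ 4) ∂P := lintegral_congr fun ω => by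
        rw [Real.enorm_eq_ofReal_abs, ← ENNReal.ofReal_pow (abs_nonneg _),
          Even.pow_abs (by decide)]
    _ = ENNReal.ofReal (3 * (v : ℝ) ^ 2) := by
        rw [← ofReal_integral_eq_lintegral_ofReal hint (ae_of_all _ fun ω => by positivity),
          integral_pow_four_of_hasLaw_gaussianReal hZ]
    _ = 3 * (v : ℝ≥0∞) ^ 2 := by
        rw [ENNReal.ofReal_mul zero_le_three, ENNReal.ofReal_pow v.coe_nonneg,
          ENNReal.ofReal_coe_nnreal, ENNReal.ofReal_ofNat]

theorem variance_sq_of_hasLaw_gaussianReal [IsProbabilityMeasure P]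
    (hZ : HasLaw Z (gaussianReal 0 v) P) : Var[fun ω => Z ω ^ 2; P] = 2 * (v : ℝ) ^ 2 := by
  rw [variance_eq_sub (memLp_sq_of_hasLaw_gaussianReal hZ), integral_sq_of_hasLaw_gaussianReal hZ]
  simp only [Pi.pow_apply, ← pow_mul]
  rw [integral_pow_four_of_hasLaw_gaussianReal hZ]
  ring

end Moments

/-! ### Brownian motion: quadratic variation and semimartingale property -/

theorem tendstoInMeasure_const_of_tendsto_variance {Ω ι : Type*} {mΩ : MeasurableSpace Ω}
    {P : Measure Ω} [IsFiniteMeasure P] {l : Filter ι} {X : ι → Ω → ℝ} {a : ℝ}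
    (hX : ∀ᶠ i in l, MemLp (X i) 2 P) (hmean : ∀ᶠ i in l, ∫ ω, X i ω ∂P = a)
    (hvar : Tendsto (fun i => Var[X i; P]) l (𝓝 0)) :
    TendstoInMeasure P X l fun _ => a := by
  rw [tendstoInMeasure_iff_norm]
  intro ε hε
  have hlim : Tendsto (fun i => ENNReal.ofReal (Var[X i; P] / ε ^ 2)) l (𝓝 0) := by
    simpa using ENNReal.tendsto_ofReal (hvar.div_const (ε ^ 2))
  refine tendsto_of_tendsto_of_tendsto_of_le_of_le' tendsto_const_nhds hlim
    (Eventually.of_forall fun _ => zero_le) ?_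
  filter_upwards [hX, hmean] with i hXi hi
  simpa only [hi, Real.norm_eq_abs] using meas_ge_le_variance_div_sq hXi hε

section BrownianMotion

variable {Ω : Type*} {mΩ : MeasurableSpace Ω} {P : Measure Ω} {T : ℝ≥0}
  {ℱ : Filtration (Time T) mΩ} {c : ℝ≥0} {B : Time T → Ω → ℝ} {π : ℕ → Time T}

namespace IsBrownianMotion

theorem indepFun_increment (hB : IsBrownianMotion P ℱ c B) {r s t u : Time T}
    (hrs : r ≤ s) (hst : s ≤ t) (htu : t ≤ u) :
    IndepFun (fun ω => B s ω - B r ω) (fun ω => B u ω - B t ω) P := by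
  rw [IndepFun_iff_Indep]
  refine (indep_of_indep_of_le_right (hB.indep_increment t u htu) ?_).symm
  have hs : Measurable[ℱ t] (B s) := ((hB.adapted s).mono (ℱ.mono hst)).measurable
  have hr : Measurable[ℱ t] (B r) := ((hB.adapted r).mono (ℱ.mono (hrs.trans hst))).measurable
  exact (hs.sub hr).comap_le

theorem pairwise_indepFun_sq_increment (hB : IsBrownianMotion P ℱ c B) (hπ : Monotone π)
    (s : Set ℕ) :
    s.Pairwise fun i j => IndepFun (fun ω => (B (π (i + 1)) ω - B (π i) ω) ^ 2)
      (fun ω => (B (π (j + 1)) ω - B (π j) ω) ^ 2) P := by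
  have hlt : ∀ {i j : ℕ}, i < j → IndepFun (fun ω => (B (π (i + 1)) ω - B (π i) ω) ^ 2)
      (fun ω => (B (π (j + 1)) ω - B (π j) ω) ^ 2) P := fun {i j} h =>
    (hB.indepFun_increment (hπ i.le_succ) (hπ h) (hπ j.le_succ)).comp
      (φ := fun x : ℝ => x ^ 2) (ψ := fun x : ℝ => x ^ 2) (by fun_prop) (by fun_prop)
  intro i _ j _ hij
  exact hij.lt_or_gt.elim hlt fun h => (hlt h).symm

theorem memLp_sq_increment (hB : IsBrownianMotion P ℱ c B) (hπ : Monotone π) (i : ℕ) :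
    MemLp (fun ω => (B (π (i + 1)) ω - B (π i) ω) ^ 2) 2 P :=
  memLp_sq_of_hasLaw_gaussianReal (hB.law_increment _ _ (hπ i.le_succ))

theorem integral_sum_sq_increment [IsFiniteMeasure P] (hB : IsBrownianMotion P ℱ c B)
    (hπ : Monotone π) (h0 : π 0 = ⊥) (N : ℕ) :
    ∫ ω, ∑ i ∈ Finset.range N, (B (π (i + 1)) ω - B (π i) ω) ^ 2 ∂P
      = c * ((π N : ℝ≥0) : ℝ) := by
  have hterm : ∀ i, ∫ ω, (B (π (i + 1)) ω - B (π i) ω) ^ 2 ∂P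
      = c * ((π (i + 1) : ℝ≥0) : ℝ) - c * ((π i : ℝ≥0) : ℝ) := fun i => by
    rw [integral_sq_of_hasLaw_gaussianReal (hB.law_increment _ _ (hπ i.le_succ)), NNReal.coe_mul,
      NNReal.coe_sub (hπ i.le_succ), mul_sub]
  rw [integral_finsetSum _ fun i _ => (hB.memLp_sq_increment hπ i).integrable one_le_two]
  simp only [hterm]
  rw [Finset.sum_range_sub (fun i => c * ((π i : ℝ≥0) : ℝ)), h0]
  simp

theorem variance_sum_sq_increment_le [IsProbabilityMeasure P] (hB : IsBrownianMotion P ℱ c B)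
    (hπ : Monotone π) {N : ℕ} {δ : ℝ} (hδ : ∀ i < N, dist (π (i + 1)) (π i) ≤ δ) :
    Var[fun ω => ∑ i ∈ Finset.range N, (B (π (i + 1)) ω - B (π i) ω) ^ 2; P]
      ≤ 2 * c ^ 2 * δ * (((π N : ℝ≥0) : ℝ) - (π 0 : ℝ≥0)) := by
  have hterm : ∀ i ∈ Finset.range N, Var[fun ω => (B (π (i + 1)) ω - B (π i) ω) ^ 2; P]
      ≤ 2 * c ^ 2 * δ * (((π (i + 1) : ℝ≥0) : ℝ) - (π i : ℝ≥0)) := by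
    intro i hi
    have hnonneg : (0 : ℝ) ≤ ((π (i + 1) : ℝ≥0) : ℝ) - (π i : ℝ≥0) :=
      sub_nonneg.2 (hπ i.le_succ)
    have hmesh : ((π (i + 1) : ℝ≥0) : ℝ) - (π i : ℝ≥0) ≤ δ :=
      (le_abs_self _).trans (hδ i (Finset.mem_range.1 hi))
    rw [variance_sq_of_hasLaw_gaussianReal (hB.law_increment _ _ (hπ i.le_succ)), NNReal.coe_mul,
      NNReal.coe_sub (hπ i.le_succ)]
    calc _ = 2 * (c : ℝ) ^ 2 * (((π (i + 1) : ℝ≥0) : ℝ) - (π i : ℝ≥0))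
          * (((π (i + 1) : ℝ≥0) : ℝ) - (π i : ℝ≥0)) := by ring
      _ ≤ 2 * (c : ℝ) ^ 2 * δ * (((π (i + 1) : ℝ≥0) : ℝ) - (π i : ℝ≥0)) := by gcongr
  rw [← Finset.sum_fn, IndepFun.variance_sum (fun i _ => hB.memLp_sq_increment hπ i)
    (hB.pairwise_indepFun_sq_increment hπ _)]
  refine (Finset.sum_le_sum hterm).trans_eq ?_
  rw [← Finset.mul_sum, Finset.sum_range_sub (fun i => ((π i : ℝ≥0) : ℝ))]

theorem hasQuadraticVariation [IsProbabilityMeasure P] (hB : IsBrownianMotion P ℱ c B) :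
    HasQuadraticVariation P B fun t _ => (c : ℝ) * ((t : ℝ≥0) : ℝ) := by
  intro t N π hmono h0 hN hmesh
  refine tendstoInMeasure_const_of_tendsto_variance
    (Eventually.of_forall fun k => memLp_finsetSum _ fun i _ => hB.memLp_sq_increment (hmono k) i)
    (Eventually.of_forall fun k => by rw [hB.integral_sum_sq_increment (hmono k) (h0 k), hN]) ?_
  refine tendsto_order.2 ⟨fun a ha => Eventually.of_forall fun k =>
    ha.trans_le (variance_nonneg _ _), fun a ha => ?_⟩
  set K : ℝ := 2 * (c : ℝ) ^ 2 * ((t : ℝ≥0) : ℝ)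
  have : 0 ≤ K := by positivity
  filter_upwards [hmesh (a / (K + 1)) (by positivity)] with k hk
  calc _ ≤ _ := hB.variance_sum_sq_increment_le (hmono k) hk
    _ = a * (K / (K + 1)) := by
        rw [hN, h0, show (((⊥ : Time T) : ℝ≥0) : ℝ) = 0 from rfl]
        ring
    _ < a := mul_lt_of_lt_one_right ha (by rw [div_lt_one (by positivity)]; linarith)

theorem martingale [IsFiniteMeasure P] (hB : IsBrownianMotion P ℱ c B) : Martingale B ℱ P := by
  have hincr : ∀ s t, s ≤ t → Integrable (fun ω => B t ω - B s ω) P := fun s t h =>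
    (hB.law_increment s t h).hasGaussianLaw.integrable
  have hint : ∀ t, Integrable (B t) P := fun t => by
    refine (hincr ⊥ t bot_le).congr ?_
    filter_upwards [hB.start_zero] with ω hω
    rw [hω, sub_zero]
  refine ⟨hB.adapted, fun s t hst => ?_⟩
  have hmeas : StronglyMeasurable fun ω => B t ω - B s ω :=
    ((hB.adapted t).mono (ℱ.le t)).sub ((hB.adapted s).mono (ℱ.le s))
  have hcond_incr : P[fun ω => B t ω - B s ω | ℱ s] =ᵐ[P] fun _ => ∫ ω, B t ω - B s ω ∂P :=
    condExp_indep_eq hmeas.measurable.comap_le (ℱ.le s)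
      (comap_measurable _).stronglyMeasurable (hB.indep_increment s t hst)
  have hcond_past : P[B s | ℱ s] = B s :=
    condExp_of_stronglyMeasurable (ℱ.le s) (hB.adapted s) (hint s)
  have hsplit : P[B t | ℱ s] =ᵐ[P] P[fun ω => B t ω - B s ω | ℱ s] + P[B s | ℱ s] := by
    refine EventuallyEq.trans ?_ (condExp_add (hincr s t hst) (hint s) _)
    exact condExp_congr_ae (ae_of_all _ fun ω => by simp)
  filter_upwards [hcond_incr, hsplit] with ω hω hsplitω
  rw [hsplitω, Pi.add_apply, hω, hcond_past,
    integral_eq_zero_of_hasLaw_gaussianReal (hB.law_increment s t hst), zero_add]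

end IsBrownianMotion

theorem isCadlag_of_continuous {f : Time T → ℝ} (hf : Continuous f) : IsCadlag f := fun t =>
  ⟨hf.continuousWithinAt, f t, hf.continuousWithinAt⟩

theorem IsBrownianMotion.isSemimartingale [IsFiniteMeasure P] (hB : IsBrownianMotion P ℱ c B) :
    IsSemimartingale P ℱ B := by
  refine ⟨hB.adapted, B, fun _ _ => 0, Locally.of_prop ⟨hB.martingale, ?_⟩,
    fun _ => stronglyMeasurable_const, ae_of_all _ fun ω => ?_, ae_of_all _ fun ω t => ?_⟩
  · exact hB.continuous_paths.mono fun ω hω => isCadlag_of_continuous hω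
  · refine ⟨isCadlag_of_continuous continuous_const, ?_⟩
    rw [BoundedVariationOn, eVariationOn.constant_on]
    · exact ENNReal.zero_ne_top
    · simp
  · simp

end BrownianMotion

/-! ### The cylindrical Wiener process -/

/-- A map between real inner product spaces that multiplies inner products by a constant `c` is
linear and bounded; this is the corresponding operator. -/
noncomputable def continuousLinearMapOfInner {E F : Type*} [NormedAddCommGroup E]
    [InnerProductSpace ℝ E] [NormedAddCommGroup F] [InnerProductSpace ℝ F] (f : E → F) {c : ℝ}
    (h : ∀ a b, inner ℝ (f a) (f b) = c * inner ℝ a b) : E →L[ℝ] F :=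
  LinearMap.mkContinuous
    { toFun := f
      map_add' := fun a b => by
        rw [← sub_eq_zero, ← inner_self_eq_zero (𝕜 := ℝ)]
        simp only [inner_sub_left, inner_sub_right, inner_add_left, inner_add_right, h]
        ring
      map_smul' := fun r a => by
        rw [← sub_eq_zero, ← inner_self_eq_zero (𝕜 := ℝ)]
        simp only [inner_sub_left, inner_sub_right, inner_smul_left, inner_smul_right, h,
          RCLike.conj_to_real, RingHom.id_apply]
        ring }
    (Real.sqrt |c|) fun x => by
      refine le_of_sq_le_sq ?_ (by positivity)
      calc ‖f x‖ ^ 2 = c * ‖x‖ ^ 2 := by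
            rw [← real_inner_self_eq_norm_sq, ← real_inner_self_eq_norm_sq, h]
        _ ≤ |c| * ‖x‖ ^ 2 := by gcongr; exact le_abs_self c
        _ = (Real.sqrt |c| * ‖x‖) ^ 2 := by rw [mul_pow, Real.sq_sqrt (abs_nonneg c)]

theorem inner_eq_integral_mul {α : Type*} [MeasurableSpace α] {μ : Measure α} (f g : Lp ℝ 2 μ) :
    inner ℝ f g = ∫ x, f x * g x ∂μ := by
  rw [L2.inner_def]
  refine integral_congr_ae (ae_of_all _ fun x => ?_)
  simp only [RCLike.inner_apply, RCLike.conj_to_real]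
  ring

theorem norm_sq_eq_integral_sq {α : Type*} [MeasurableSpace α] {μ : Measure α} (f : Lp ℝ 2 μ) :
    ‖f‖ ^ 2 = ∫ x, f x ^ 2 ∂μ := by
  rw [← real_inner_self_eq_norm_sq, inner_eq_integral_mul]
  simp only [pow_two]

section WhiteNoise

variable {T : ℝ≥0} {d : ℕ}

theorem indicatorTensor_mul_indicatorTensor (s t : Time T) (φ ψ : SpaceL2 d) :
    (fun p => indicatorTensor s φ p * indicatorTensor t ψ p) =ᵐ[spaceTimeMeasure T d]
      fun p => (Set.Icc 0 (((min s t : Time T) : ℝ≥0) : ℝ)).indicator 1 p.1 * (φ p.2 * ψ p.2) := by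
  have hmin : (((min s t : Time T) : ℝ≥0) : ℝ) = min ((s : ℝ≥0) : ℝ) ((t : ℝ≥0) : ℝ) := by
    rcases le_total s t with hst | hst
    · rw [min_eq_left hst, min_eq_left (by exact_mod_cast hst)]
    · rw [min_eq_right hst, min_eq_right (by exact_mod_cast hst)]
  filter_upwards [(memLp_indicatorTensor s φ).coeFn_toLp, (memLp_indicatorTensor t ψ).coeFn_toLp]
    with p hs ht
  rw [indicatorTensor, indicatorTensor, hs, ht]
  simp only [Set.indicator_apply, Set.mem_prod, Set.mem_Icc, Set.mem_univ, and_true, hmin,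
    le_min_iff, Pi.one_apply]
  split_ifs <;> simp_all

theorem inner_indicatorTensor (s t : Time T) (φ ψ : SpaceL2 d) :
    inner ℝ (indicatorTensor s φ) (indicatorTensor t ψ)
      = ((min s t : Time T) : ℝ≥0) * inner ℝ φ ψ := by
  rw [inner_eq_integral_mul, integral_congr_ae (indicatorTensor_mul_indicatorTensor s t φ ψ),
    spaceTimeMeasure, integral_prod_mul (L := ℝ)
    (fun r : ℝ => (Set.Icc 0 (((min s t : Time T) : ℝ≥0) : ℝ)).indicator 1 r)
    (fun x => φ x * ψ x), inner_eq_integral_mul, integral_indicator_one measurableSet_Icc,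
    measureReal_restrict_apply measurableSet_Icc,
    Set.inter_eq_left.2 (Set.Icc_subset_Icc_right (by exact_mod_cast (min s t).2))]
  simp

namespace IsSpaceTimeWhiteNoise

variable {Ω : Type*} {mΩ : MeasurableSpace Ω} {P : Measure Ω} {Wdot : SpaceTimeL2 T d → Lp ℝ 2 P}

theorem inner_eq (hW : IsSpaceTimeWhiteNoise P Wdot) (ξ η : SpaceTimeL2 T d) :
    inner ℝ (Wdot ξ) (Wdot η) = inner ℝ ξ η := by
  rw [inner_eq_integral_mul, inner_eq_integral_mul, hW.covariance]

/-- White noise as an isometric operator. -/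
noncomputable def toCLM (hW : IsSpaceTimeWhiteNoise P Wdot) : SpaceTimeL2 T d →L[ℝ] Lp ℝ 2 P :=
  continuousLinearMapOfInner (c := 1) Wdot fun ξ η => by rw [hW.inner_eq, one_mul]

theorem norm_eq (hW : IsSpaceTimeWhiteNoise P Wdot) (ξ : SpaceTimeL2 T d) : ‖Wdot ξ‖ = ‖ξ‖ := by
  rw [norm_eq_sqrt_real_inner, norm_eq_sqrt_real_inner, hW.inner_eq]

theorem hasLaw (hW : IsSpaceTimeWhiteNoise P Wdot) (ξ : SpaceTimeL2 T d) :
    HasLaw (Wdot ξ) (gaussianReal 0 (‖ξ‖₊ ^ 2)) P := by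
  have hgauss : HasGaussianLaw (Wdot ξ) P := hW.gaussian.hasGaussianLaw_eval ξ
  refine ⟨hgauss.aemeasurable, ?_⟩
  rw [hgauss.map_eq_gaussianReal, variance_of_integral_eq_zero hgauss.aemeasurable
    (hW.mean_zero ξ), hW.mean_zero, ← norm_sq_eq_integral_sq, hW.norm_eq,
    Real.toNNReal_pow (norm_nonneg _), norm_toNNReal]

theorem inner_cylindricalWiener (hW : IsSpaceTimeWhiteNoise P Wdot) (s t : Time T)
    (φ ψ : SpaceL2 d) :
    inner ℝ (cylindricalWiener Wdot s φ) (cylindricalWiener Wdot t ψ)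
      = ((min s t : Time T) : ℝ≥0) * inner ℝ φ ψ := by
  rw [cylindricalWiener, cylindricalWiener, hW.inner_eq, inner_indicatorTensor]

/-- For fixed `t`, the cylindrical Wiener process as a bounded operator. -/
noncomputable def wienerCLM (hW : IsSpaceTimeWhiteNoise P Wdot) (t : Time T) :
    SpaceL2 d →L[ℝ] Lp ℝ 2 P :=
  continuousLinearMapOfInner (cylindricalWiener Wdot t) (hW.inner_cylindricalWiener t t)

theorem wienerCLM_apply (hW : IsSpaceTimeWhiteNoise P Wdot) (t : Time T) (φ : SpaceL2 d) :
    hW.wienerCLM t φ = cylindricalWiener Wdot t φ :=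
  rfl

theorem cylindricalWiener_sub (hW : IsSpaceTimeWhiteNoise P Wdot) (s t : Time T) (φ : SpaceL2 d) :
    cylindricalWiener Wdot t φ - cylindricalWiener Wdot s φ
      = Wdot (indicatorTensor t φ - indicatorTensor s φ) :=
  (map_sub hW.toCLM _ _).symm

theorem cylindricalWiener_bot (hW : IsSpaceTimeWhiteNoise P Wdot) (φ : SpaceL2 d) :
    cylindricalWiener Wdot ⊥ φ = 0 := by
  have hbot : ((⊥ : Time T) : ℝ≥0) = 0 := rfl
  rw [← inner_self_eq_zero (𝕜 := ℝ), hW.inner_cylindricalWiener, min_self, hbot, NNReal.coe_zero,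
    zero_mul]

theorem hasLaw_cylindricalWiener_sub (hW : IsSpaceTimeWhiteNoise P Wdot) {s t : Time T}
    (hst : s ≤ t) (φ : SpaceL2 d) :
    HasLaw (cylindricalWiener Wdot t φ - cylindricalWiener Wdot s φ : Lp ℝ 2 P)
      (gaussianReal 0 (‖φ‖₊ ^ 2 * ((t : ℝ≥0) - (s : ℝ≥0)))) P := by
  have hst' : (s : ℝ≥0) ≤ t := hst
  have hnorm : ‖indicatorTensor t φ - indicatorTensor s φ‖₊ ^ 2
      = ‖φ‖₊ ^ 2 * ((t : ℝ≥0) - (s : ℝ≥0)) := by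
    apply NNReal.eq
    push_cast [NNReal.coe_sub hst']
    rw [← real_inner_self_eq_norm_sq]
    simp only [inner_sub_left, inner_sub_right, inner_indicatorTensor, min_self, min_eq_left hst,
      min_eq_right hst]
    rw [real_inner_self_eq_norm_sq]
    ring
  rw [hW.cylindricalWiener_sub, ← hnorm]
  exact hW.hasLaw _

theorem covariance_eq_inner (hW : IsSpaceTimeWhiteNoise P Wdot) (ξ η : SpaceTimeL2 T d) :
    cov[Wdot ξ, Wdot η; P] = inner ℝ ξ η := by
  have := hW.gaussian.isProbabilityMeasure
  rw [covariance_eq_sub (Lp.memLp _) (Lp.memLp _), ← hW.inner_eq, inner_eq_integral_mul,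
    hW.mean_zero, zero_mul, sub_zero]
  rfl

theorem indepFun_cylindricalWiener_sub (hW : IsSpaceTimeWhiteNoise P Wdot) {s t : Time T}
    (hst : s ≤ t) (φ : SpaceL2 d) :
    IndepFun (cylindricalWiener Wdot t φ - cylindricalWiener Wdot s φ : Lp ℝ 2 P)
      (fun ω (p : Set.Iic s × SpaceL2 d) => cylindricalWiener Wdot p.1 p.2 ω) P := by
  have := hW.gaussian.isProbabilityMeasure
  let increment (_ : Unit) : Ω → ℝ :=
    (cylindricalWiener Wdot t φ - cylindricalWiener Wdot s φ : Lp ℝ 2 P)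
  let past (p : Set.Iic s × SpaceL2 d) : Ω → ℝ := cylindricalWiener Wdot p.1 p.2
  have hgauss : IsGaussianProcess (Sum.elim increment past) P := by
    have heq : Sum.elim increment past = (fun ξ ω => Wdot ξ ω) ∘
        Sum.elim (fun _ => indicatorTensor t φ - indicatorTensor s φ)
          fun p => indicatorTensor p.1.1 p.2 := by
      funext q
      rcases q with q | q
      · exact congrArg (fun f : Lp ℝ 2 P => (f : Ω → ℝ)) (hW.cylindricalWiener_sub s t φ)
      · rfl
    rw [heq]
    exact hW.gaussian.comp_right _
  refine (hgauss.indepFun_of_covariance_eq_zero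
    (fun _ => (Lp.stronglyMeasurable _).aemeasurable)
    (fun _ => (Lp.stronglyMeasurable _).aemeasurable) fun _ p => ?_).comp
      (measurable_pi_apply ()) measurable_id
  have hps : p.1.1 ≤ s := p.1.2
  simp only [increment, past]
  rw [hW.cylindricalWiener_sub, cylindricalWiener, hW.covariance_eq_inner, inner_sub_left,
    inner_indicatorTensor, inner_indicatorTensor, min_eq_right hps, min_eq_right (hps.trans hst),
    sub_self]

end IsSpaceTimeWhiteNoise

section Filtration

variable {Ω : Type*} {mΩ : MeasurableSpace Ω}

/-- The natural filtration of the cylindrical Wiener process, augmented by null sets. -/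
noncomputable def wienerFiltration (P : Measure Ω) (Wdot : SpaceTimeL2 T d → Lp ℝ 2 P) :
    Filtration (Time T) mΩ where
  seq t := mΩ ⊓ eventuallyMeasurableSpace
    (MeasurableSpace.comap (fun ω (p : Set.Iic t × SpaceL2 d) =>
      cylindricalWiener Wdot p.1 p.2 ω) inferInstance) (ae P)
  mono' := by
    intro s t hst
    refine inf_le_inf_left _ ?_
    rintro A ⟨_, ⟨C, hC, rfl⟩, hA⟩
    let restrict : (Set.Iic t × SpaceL2 d → ℝ) → (Set.Iic s × SpaceL2 d → ℝ) :=
      fun f p => f (⟨p.1, p.1.2.trans hst⟩, p.2)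
    have hrestrict : Measurable restrict :=
      measurable_pi_lambda _ fun p => measurable_pi_apply _
    exact ⟨_, ⟨restrict ⁻¹' C, hrestrict hC, rfl⟩, hA⟩
  le' t := inf_le_left

variable {P : Measure Ω} {Wdot : SpaceTimeL2 T d → Lp ℝ 2 P}

theorem stronglyMeasurable_wienerFiltration {t : Time T} {φ : SpaceL2 d} {X : Ω → ℝ}
    (hXm : StronglyMeasurable X) (hX : X =ᵐ[P] cylindricalWiener Wdot t φ) :
    StronglyMeasurable[wienerFiltration P Wdot t] X := by
  refine Measurable.stronglyMeasurable fun A hA =>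
    MeasurableSpace.measurableSet_inf.2 ⟨hXm.measurable hA, ?_⟩
  have heval : Measurable fun f : Set.Iic t × SpaceL2 d → ℝ => f (⟨t, Set.self_mem_Iic⟩, φ) :=
    measurable_pi_apply ((⟨t, Set.self_mem_Iic⟩, φ) : Set.Iic t × SpaceL2 d)
  exact ⟨cylindricalWiener Wdot t φ ⁻¹' A, ⟨_, heval hA, rfl⟩, hX.preimage A⟩

theorem indep_wienerFiltration_of_indepFun {s : Time T} {X Z : Ω → ℝ}
    (hX : IndepFun X (fun ω (p : Set.Iic s × SpaceL2 d) => cylindricalWiener Wdot p.1 p.2 ω) P)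
    (hZ : Z =ᵐ[P] X) :
    Indep (MeasurableSpace.comap Z inferInstance) (wienerFiltration P Wdot s) P := by
  rw [Indep_iff]
  rintro _ B ⟨A, hA, rfl⟩ hB
  obtain ⟨-, _, ⟨C, hC, rfl⟩, hBC⟩ := MeasurableSpace.measurableSet_inf.1 hB
  have hZA : Z ⁻¹' A =ᵐ[P] X ⁻¹' A := hZ.preimage A
  rw [measure_congr (hZA.inter hBC), measure_congr hZA, measure_congr hBC]
  exact indepFun_iff_measure_inter_preimage_eq_mul.1 hX _ _ hA hC

theorem IsSpaceTimeWhiteNoise.isBrownianMotion (hW : IsSpaceTimeWhiteNoise P Wdot)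
    {φ : SpaceL2 d} {X : Time T → Ω → ℝ} (hXm : ∀ t, StronglyMeasurable (X t))
    (hX : ∀ t, X t =ᵐ[P] cylindricalWiener Wdot t φ) (hXc : ∀ᵐ ω ∂P, Continuous fun t => X t ω) :
    IsBrownianMotion P (wienerFiltration P Wdot) (‖φ‖₊ ^ 2) X := by
  have hsub (s t : Time T) : (fun ω => X t ω - X s ω) =ᵐ[P]
      (cylindricalWiener Wdot t φ - cylindricalWiener Wdot s φ : Lp ℝ 2 P) :=
    ((hX t).sub (hX s)).trans (Lp.coeFn_sub _ _).symm
  refine ⟨fun t => stronglyMeasurable_wienerFiltration (hXm t) (hX t), ?_, hXc,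
    fun s t hst => (hW.hasLaw_cylindricalWiener_sub hst φ).congr (hsub s t),
    fun s t hst => indep_wienerFiltration_of_indepFun
      (hW.indepFun_cylindricalWiener_sub hst φ) (hsub s t)⟩
  have hbot := hX ⊥
  rw [hW.cylindricalWiener_bot] at hbot
  exact hbot.trans (Lp.coeFn_zero ℝ 2 P)

end Filtration

end WhiteNoise

/-! ### Smooth functions as convolutions with an exponential kernel -/

section ExpKernel

variable {V : Type*} [NormedAddCommGroup V] [NormedSpace ℝ V]

/-- The product of the differential operators `1 + ∂_v`, where `v` ranges over a list of
directions. -/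
noncomputable def onePlusDeriv (l : List V) (f : V → ℝ) : V → ℝ :=
  l.foldr (fun v g x => g x + fderiv ℝ g x v) f

theorem contDiff_onePlusDeriv {f : V → ℝ} (hf : ContDiff ℝ (⊤ : ℕ∞) f) (l : List V) :
    ContDiff ℝ (⊤ : ℕ∞) (onePlusDeriv l f) := by
  induction l with
  | nil => exact hf
  | cons v l ih =>
    exact ih.add ((ih.fderiv_right (m := (⊤ : ℕ∞)) (by simp)).clm_apply contDiff_const)

theorem hasCompactSupport_onePlusDeriv {f : V → ℝ} (hf : HasCompactSupport f) (l : List V) :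
    HasCompactSupport (onePlusDeriv l f) := by
  induction l with
  | nil => exact hf
  | cons v l ih => exact ih.add (ih.fderiv_apply (𝕜 := ℝ) v)

theorem exists_norm_onePlusDeriv_le {f : V → ℝ} (hf : ContDiff ℝ (⊤ : ℕ∞) f)
    (hc : HasCompactSupport f) (l : List V) : ∃ C, ∀ x, ‖onePlusDeriv l f x‖ ≤ C :=
  (contDiff_onePlusDeriv hf l).continuous.bounded_above_of_compact_support
    (hasCompactSupport_onePlusDeriv hc l)

/-- The density of the exponential law with parameter `1`. -/
noncomputable def expDensity : ℝ → ℝ :=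
  (Set.Ioi 0).indicator fun s => Real.exp (-s)

theorem expDensity_nonneg (s : ℝ) : 0 ≤ expDensity s :=
  Set.indicator_nonneg (fun _ _ => (Real.exp_pos _).le) s

theorem expDensity_le_one (s : ℝ) : expDensity s ≤ 1 :=
  Set.indicator_le' (fun s hs => Real.exp_le_one_iff.2 (by simpa using le_of_lt hs))
    (fun _ _ => zero_le_one) s

theorem measurable_expDensity : Measurable expDensity :=
  (by fun_prop : Measurable fun s : ℝ => Real.exp (-s)).indicator measurableSet_Ioi

theorem integrable_expDensity : Integrable expDensity :=
  (integrableOn_exp_neg_Ioi 0).integrable_indicator measurableSet_Ioi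

theorem tendsto_exp_neg_mul_zero {g : ℝ → ℝ} {C : ℝ} (hg : ∀ s, ‖g s‖ ≤ C) :
    Tendsto (fun s => Real.exp (-s) * g s) atTop (𝓝 0) :=
  (Real.tendsto_exp_neg_atTop_nhds_zero).zero_mul_isBoundedUnder_le
    (isBoundedUnder_of ⟨C, hg⟩)

theorem integral_expDensity_mul_onePlusDeriv {f : V → ℝ} (hf : ContDiff ℝ (⊤ : ℕ∞) f)
    (hc : HasCompactSupport f) (x v : V) :
    ∫ s, expDensity s * onePlusDeriv [v] f (x - s • v) = f x := by
  have hderiv (s : ℝ) : HasDerivAt (fun s : ℝ => -(Real.exp (-s) * f (x - s • v)))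
      (Real.exp (-s) * onePlusDeriv [v] f (x - s • v)) s := by
    have hexp : HasDerivAt (fun s : ℝ => Real.exp (-s)) (Real.exp (-s) * -1) s :=
      (hasDerivAt_neg s).exp
    have hline : HasDerivAt (fun s : ℝ => x - s • v) (-((1 : ℝ) • v)) s :=
      ((hasDerivAt_id s).smul_const v).const_sub x
    have hcomp := (hf.differentiable (by simp) (x - s • v)).hasFDerivAt.comp_hasDerivAt s hline
    refine (hexp.mul hcomp).neg.congr_deriv ?_
    simp only [onePlusDeriv, List.foldr_cons, List.foldr_nil, map_neg, one_smul,
      Function.comp_apply]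
    ring
  obtain ⟨C, hC⟩ := hf.continuous.bounded_above_of_compact_support hc
  obtain ⟨C', hC'⟩ := exists_norm_onePlusDeriv_le hf hc [v]
  have hlim : Tendsto (fun s : ℝ => -(Real.exp (-s) * f (x - s • v))) atTop (𝓝 0) := by
    simpa using (tendsto_exp_neg_mul_zero fun s => hC (x - s • v)).neg
  have hcont : Continuous fun s : ℝ => onePlusDeriv [v] f (x - s • v) :=
    (contDiff_onePlusDeriv hf [v]).continuous.comp (by fun_prop)
  have hint : IntegrableOn (fun s => Real.exp (-s) * onePlusDeriv [v] f (x - s • v))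
      (Set.Ioi 0) :=
    (integrableOn_exp_neg_Ioi 0).mul_bdd hcont.aestronglyMeasurable (ae_of_all _ fun s => hC' _)
  have hindicator (s : ℝ) : expDensity s * onePlusDeriv [v] f (x - s • v) = (Set.Ioi 0).indicator
      (fun s => Real.exp (-s) * onePlusDeriv [v] f (x - s • v)) s :=
    (Set.indicator_mul_left _ _ fun s => onePlusDeriv [v] f (x - s • v)).symm
  simp only [hindicator]
  rw [integral_indicator measurableSet_Ioi, integral_Ioi_of_hasDerivAt_of_tendsto
    (hderiv 0).continuousAt.continuousWithinAt (fun s _ => hderiv s) hint hlim]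
  simp

theorem integrable_prod_expDensity (n : ℕ) :
    Integrable fun u : Fin n → ℝ => ∏ i, expDensity (u i) :=
  Integrable.fintype_prod fun _ => integrable_expDensity

theorem integral_prod_expDensity_mul_onePlusDeriv {f : V → ℝ} (hf : ContDiff ℝ (⊤ : ℕ∞) f)
    (hc : HasCompactSupport f) {n : ℕ} (v : Fin n → V) (x : V) :
    ∫ u : Fin n → ℝ, (∏ i, expDensity (u i)) *
      onePlusDeriv (List.ofFn v) f (x - ∑ i, u i • v i) = f x := by
  induction n generalizing x with
  | zero => simp [onePlusDeriv, integral_unique, Measure.real, volume_pi]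
  | succ n ih =>
    set g := onePlusDeriv (List.ofFn fun i => v (Fin.succ i)) f with hg
    have hgs : ContDiff ℝ (⊤ : ℕ∞) g := contDiff_onePlusDeriv hf _
    have hgc : HasCompactSupport g := hasCompactSupport_onePlusDeriv hc _
    have hofFn : onePlusDeriv (List.ofFn v) f = onePlusDeriv [v 0] g := by
      rw [List.ofFn_succ]
      rfl
    have hint : Integrable fun u : Fin (n + 1) → ℝ => (∏ i, expDensity (u i)) *
        onePlusDeriv [v 0] g (x - ∑ i, u i • v i) := by
      obtain ⟨C, hC⟩ := exists_norm_onePlusDeriv_le hgs hgc [v 0]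
      exact (integrable_prod_expDensity _).mul_bdd ((contDiff_onePlusDeriv hgs _).continuous.comp
        (by fun_prop)).aestronglyMeasurable (ae_of_all _ fun u => hC _)
    have mp := (volume_preserving_piFinSuccAbove (fun _ : Fin (n + 1) => ℝ) 0).symm
    have hcons (s : ℝ) (w : Fin n → ℝ) :
        (MeasurableEquiv.piFinSuccAbove (fun _ : Fin (n + 1) => ℝ) 0).symm (s, w)
          = Fin.cons s w := by
      simp [MeasurableEquiv.piFinSuccAbove, Fin.insertNthEquiv]
    rw [hofFn, ← mp.integral_comp (MeasurableEquiv.measurableEmbedding _)]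
    have hint' := (mp.integrable_comp_emb (MeasurableEquiv.measurableEmbedding _)).2 hint
    rw [Measure.volume_eq_prod] at hint' ⊢
    refine (integral_prod_symm _ hint').trans ?_
    rw [← ih (fun i => v i.succ) x]
    congr 1 with w
    simp only [Function.comp_apply, hcons, Fin.prod_univ_succ, Fin.sum_univ_succ, Fin.cons_zero,
      Fin.cons_succ]
    rw [← hg, ← integral_expDensity_mul_onePlusDeriv hgs hgc _ (v 0), ← integral_const_mul]
    congr 1 with s
    rw [sub_sub, add_comm (s • v 0)]
    ring

end ExpKernel

section SpaceKernel

variable {d : ℕ}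

/-- The kernel `∏ 1_{u_i > 0} e^{-u_i}` on `ℝ^d`, a fundamental solution of `∏ (1 + ∂_i)`. -/
noncomputable def expKernel (u : Space d) : ℝ :=
  ∏ i, expDensity (u i)

/-- The differential operator `∏ (1 + ∂_i)` on `ℝ^d`, a right inverse of convolution with
`expKernel`. -/
noncomputable def expKernelInv (f : Space d → ℝ) : Space d → ℝ :=
  onePlusDeriv (List.ofFn fun i => EuclideanSpace.single i 1) f

theorem contDiff_expKernelInv {f : Space d → ℝ} (hf : ContDiff ℝ (⊤ : ℕ∞) f) :
    ContDiff ℝ (⊤ : ℕ∞) (expKernelInv f) :=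
  contDiff_onePlusDeriv hf _

theorem hasCompactSupport_expKernelInv {f : Space d → ℝ} (hf : HasCompactSupport f) :
    HasCompactSupport (expKernelInv f) :=
  hasCompactSupport_onePlusDeriv hf _

theorem integral_expKernel_mul_expKernelInv {f : Space d → ℝ} (hf : ContDiff ℝ (⊤ : ℕ∞) f)
    (hc : HasCompactSupport f) (x : Space d) :
    ∫ u, expKernel u * expKernelInv f (x - u) = f x := by
  have hsum (u : Fin d → ℝ) :
      ∑ i, u i • (EuclideanSpace.single i 1 : Space d) = WithLp.toLp 2 u := by
    ext j
    simp [Finset.sum_apply, Pi.single_apply]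
  rw [← integral_prod_expDensity_mul_onePlusDeriv hf hc
    (fun i => (EuclideanSpace.single i 1 : Space d)) x,
    ← (EuclideanSpace.volume_preserving_symm_measurableEquiv_toLp (Fin d)).integral_comp
      (MeasurableEquiv.measurableEmbedding _)]
  simp only [hsum]
  rfl

theorem measurable_expKernel : Measurable (expKernel (d := d)) :=
  Finset.measurable_prod _ fun i _ => measurable_expDensity.comp (by fun_prop)

theorem memLp_expKernel : MemLp (expKernel (d := d)) 2 := by
  have hint : Integrable (expKernel (d := d)) :=
    ((EuclideanSpace.volume_preserving_symm_measurableEquiv_toLp (Fin d)).integrable_comp_emb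
      (MeasurableEquiv.measurableEmbedding _)).2 (integrable_prod_expDensity d)
  have hle (u : Space d) : ‖expKernel u‖ ≤ 1 := by
    rw [expKernel, Real.norm_of_nonneg (Finset.prod_nonneg fun _ _ => expDensity_nonneg _)]
    exact Finset.prod_le_one (fun _ _ => expDensity_nonneg _) fun _ _ => expDensity_le_one _
  rw [memLp_two_iff_integrable_sq measurable_expKernel.aestronglyMeasurable]
  simp only [pow_two]
  exact hint.bdd_mul measurable_expKernel.aestronglyMeasurable (ae_of_all _ hle)

end SpaceKernel

/-! ### Hilbert–Schmidt operators -/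

theorem countable_of_orthonormal {H ι : Type*} [NormedAddCommGroup H] [InnerProductSpace ℝ H]
    [TopologicalSpace.SeparableSpace H] {b : ι → H} (hb : Orthonormal ℝ b) : Countable ι := by
  refine Pairwise.countable_of_isOpen_disjoint (s := fun i => Metric.ball (b i) (1 / 2)) ?_
    (fun i => Metric.isOpen_ball) (fun i => ⟨b i, Metric.mem_ball_self (by norm_num)⟩)
  intro i j hij
  refine Metric.ball_disjoint_ball ?_
  have h : ‖b i - b j‖ ^ 2 = 2 := by
    rw [norm_sub_sq_real, hb.1, hb.1, hb.2 hij]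
    norm_num
  rw [dist_eq_norm]
  nlinarith [norm_nonneg (b i - b j)]

theorem tsum_enorm_inner_sq {H ι : Type*} [NormedAddCommGroup H] [InnerProductSpace ℝ H]
    (b : HilbertBasis ι ℝ H) (x : H) : ∑' i, ‖inner ℝ (b i) x‖ₑ ^ 2 = ‖x‖ₑ ^ 2 := by
  have hterm (i : ι) : ‖inner ℝ (b i) x‖ₑ ^ 2
      = ENNReal.ofReal (inner ℝ x (b i) * inner ℝ (b i) x) := by
    rw [← enorm_pow, Real.enorm_eq_ofReal (sq_nonneg _), real_inner_comm x, sq]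
  rw [tsum_congr hterm, ← ENNReal.ofReal_tsum_of_nonneg
    (fun i => by rw [real_inner_comm x]; exact mul_self_nonneg _) (b.summable_inner_mul_inner x x),
    b.tsum_inner_mul_inner, real_inner_self_eq_norm_sq, ENNReal.ofReal_pow (norm_nonneg _),
    ofReal_norm]

section IntegralOperator

variable {α : Type*} [MeasurableSpace α] {μ : Measure α}
  {H : Type*} [NormedAddCommGroup H]

theorem enorm_sq_eq_lintegral (f : Lp H 2 μ) : ‖f‖ₑ ^ 2 = ∫⁻ x, ‖f x‖ₑ ^ 2 ∂μ := by
  have h := eLpNorm_nnreal_pow_eq_lintegral (p := 2) (f := f) (μ := μ) two_ne_zero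
  simpa [Lp.enorm_def] using h

variable [InnerProductSpace ℝ H]

theorem integrable_smul_of_Lp_two (h : Lp ℝ 2 μ) (G : Lp H 2 μ) :
    Integrable (fun x => h x • G x) μ :=
  memLp_one_iff_integrable.1 ((Lp.memLp G).smul (Lp.memLp h))

variable [CompleteSpace H]

/-- The operator `h ↦ ∫ h(x) G(x) dμ(x)` from `L²(μ)` to `H` defined by an `H`-valued square
integrable function `G`. -/
noncomputable def integralOperator (G : Lp H 2 μ) : Lp ℝ 2 μ →L[ℝ] H :=
  ((ContinuousLinearMap.lsmul ℝ ℝ).lpPairing μ 2 2).flip G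

theorem integralOperator_apply (G : Lp H 2 μ) (h : Lp ℝ 2 μ) :
    integralOperator G h = ∫ x, h x • G x ∂μ :=
  (ContinuousLinearMap.lsmul ℝ ℝ).lpPairing_eq_integral h G

theorem inner_integralOperator (G : Lp H 2 μ) (h : Lp ℝ 2 μ) (c : H) :
    inner ℝ c (integralOperator G h) = inner ℝ h ((innerSL ℝ c).compLp G) := by
  rw [integralOperator_apply, ← integral_inner (integrable_smul_of_Lp_two h G),
    inner_eq_integral_mul]
  refine integral_congr_ae ?_
  filter_upwards [(innerSL ℝ c).coeFn_compLp G] with x hx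
  rw [hx, innerSL_apply_apply, inner_smul_right]

/-- Expand along a basis of `H` as well: by Parseval both sides are the double sum of the squared
matrix coefficients. -/
theorem tsum_enorm_integralOperator_sq [TopologicalSpace.SeparableSpace H] (G : Lp H 2 μ)
    {ι : Type*} (b : HilbertBasis ι ℝ (Lp ℝ 2 μ)) :
    ∑' i, ‖integralOperator G (b i)‖ₑ ^ 2 = ∫⁻ x, ‖G x‖ₑ ^ 2 ∂μ := by
  obtain ⟨w, c, -⟩ := exists_hilbertBasis ℝ H
  have : Countable w := countable_of_orthonormal c.orthonormal
  have hcoeff (j : w) : ∑' i, ‖inner ℝ (c j) (integralOperator G (b i))‖ₑ ^ 2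
      = ∫⁻ x, ‖inner ℝ (c j) (G x)‖ₑ ^ 2 ∂μ := by
    simp only [inner_integralOperator]
    rw [tsum_enorm_inner_sq b, enorm_sq_eq_lintegral]
    refine lintegral_congr_ae ?_
    filter_upwards [(innerSL ℝ (c j)).coeFn_compLp G] with x hx
    rw [hx, innerSL_apply_apply]
  calc ∑' i, ‖integralOperator G (b i)‖ₑ ^ 2
      = ∑' i, ∑' j, ‖inner ℝ (c j) (integralOperator G (b i))‖ₑ ^ 2 := by
        simp only [tsum_enorm_inner_sq c]
    _ = ∑' j, ∫⁻ x, ‖inner ℝ (c j) (G x)‖ₑ ^ 2 ∂μ := by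
        rw [ENNReal.tsum_comm]
        simp only [hcoeff]
    _ = ∫⁻ x, ∑' j, ‖inner ℝ (c j) (G x)‖ₑ ^ 2 ∂μ :=
        (lintegral_tsum fun j =>
          ((Lp.aestronglyMeasurable G).const_inner (c := c j)).enorm.pow_const 2).symm
    _ = ∫⁻ x, ‖G x‖ₑ ^ 2 ∂μ := by simp only [tsum_enorm_inner_sq c]

theorem tsum_enorm_integralOperator_sq_ne_top [TopologicalSpace.SeparableSpace H] (G : Lp H 2 μ)
    {ι : Type*} (b : HilbertBasis ι ℝ (Lp ℝ 2 μ)) :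
    ∑' i, ‖integralOperator G (b i)‖ₑ ^ 2 ≠ ∞ := by
  rw [tsum_enorm_integralOperator_sq, ← enorm_sq_eq_lintegral]
  exact ENNReal.pow_ne_top enorm_ne_top

end IntegralOperator

/-! ### Gaussian random vectors -/

section RandomVector

variable {Ω : Type*} {mΩ : MeasurableSpace Ω} {P : Measure Ω}
  {H : Type*} [NormedAddCommGroup H] [InnerProductSpace ℝ H]

/-- The random vector `ω ↦ Z(ω) h`, as a continuous linear function of `Z`. -/
noncomputable def tensorLp (P : Measure Ω) (h : H) : Lp ℝ 2 P →L[ℝ] Lp H 2 P :=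
  (ContinuousLinearMap.toSpanSingleton ℝ h).compLpL 2 P

theorem coeFn_tensorLp (h : H) (Z : Lp ℝ 2 P) : tensorLp P h Z =ᵐ[P] fun ω => Z ω • h := by
  filter_upwards [(ContinuousLinearMap.toSpanSingleton ℝ h).coeFn_compLpL (p := 2) Z] with ω hω
  rw [tensorLp, hω, ContinuousLinearMap.toSpanSingleton_apply]

theorem inner_tensorLp (h h' : H) (Z Z' : Lp ℝ 2 P) :
    inner ℝ (tensorLp P h Z) (tensorLp P h' Z') = inner ℝ Z Z' * inner ℝ h h' := by
  rw [L2.inner_def, inner_eq_integral_mul, ← integral_mul_const]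
  refine integral_congr_ae ?_
  filter_upwards [coeFn_tensorLp h Z, coeFn_tensorLp h' Z'] with ω h1 h2
  rw [h1, h2, real_inner_smul_left, real_inner_smul_right]
  ring

theorem norm_tensorLp (h : H) (Z : Lp ℝ 2 P) : ‖tensorLp P h Z‖ = ‖Z‖ * ‖h‖ := by
  rw [← sq_eq_sq₀ (norm_nonneg _) (by positivity), ← real_inner_self_eq_norm_sq, inner_tensorLp,
    real_inner_self_eq_norm_sq, real_inner_self_eq_norm_sq, mul_pow]

theorem summable_tensorLp [CompleteSpace H] {ι : Type*} {b : ι → H} (hb : Orthonormal ℝ b)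
    {D : ι → Lp ℝ 2 P} (hD : Summable fun j => ‖D j‖ ^ 2) :
    Summable fun j => tensorLp P (b j) (D j) := by
  let V : ι → Lp ℝ 2 P →ₗᵢ[ℝ] Lp H 2 P := fun j =>
    { toLinearMap := (tensorLp P (b j)).toLinearMap
      norm_map' := fun Z => (norm_tensorLp (b j) Z).trans (by rw [hb.1, mul_one]) }
  have hV : OrthogonalFamily ℝ (fun _ : ι => Lp ℝ 2 P) V := fun i j hij Z Z' =>
    (inner_tensorLp (b i) (b j) Z Z').trans (by rw [hb.2 hij, mul_zero])
  exact (hV.summable_iff_norm_sq_summable D).2 hD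

theorem exists_inner_eq_of_summable [CompleteSpace H] {ι : Type*} (b : HilbertBasis ι ℝ H)
    (L : H →L[ℝ] Lp ℝ 2 P) (hL : Summable fun j => ‖L (b j)‖ ^ 2) :
    ∃ Z : Lp H 2 P, ∀ c, (fun ω => inner ℝ c (Z ω)) =ᵐ[P] L c := by
  obtain ⟨Z, hZ⟩ := summable_tensorLp b.orthonormal hL
  refine ⟨Z, fun c => ?_⟩
  have hterm (j : ι) : (innerSL ℝ c).compLpL 2 P (tensorLp P (b j) (L (b j)))
      = L (b.repr c j • b j) := by
    rw [map_smul]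
    apply Lp.ext
    filter_upwards [(innerSL ℝ c).coeFn_compLpL (p := 2) (tensorLp P (b j) (L (b j))),
      coeFn_tensorLp (b j) (L (b j)), Lp.coeFn_smul (b.repr c j) (L (b j))] with ω h1 h2 h3
    rw [h1, h2, h3, Pi.smul_apply, map_smul, innerSL_apply_apply, b.repr_apply_apply,
      real_inner_comm, smul_eq_mul, smul_eq_mul, mul_comm]
  have hsum := ((innerSL ℝ c).compLpL 2 P).hasSum hZ
  simp only [hterm] at hsum
  rw [← hsum.unique (L.hasSum (b.hasSum_repr c))]
  exact ((innerSL ℝ c).coeFn_compLpL (p := 2) Z).symm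

theorem lintegral_mul_sq_le_of_lintegral_pow_four {f g : Ω → ℝ≥0∞} (hf : AEMeasurable f P)
    (hg : AEMeasurable g P) {M u v : ℝ≥0∞} (hfu : ∫⁻ ω, f ω ^ 4 ∂P = M * u ^ 2)
    (hgv : ∫⁻ ω, g ω ^ 4 ∂P = M * v ^ 2) : ∫⁻ ω, f ω ^ 2 * g ω ^ 2 ∂P ≤ M * (u * v) := by
  have hsqrt (w : ℝ≥0∞) : (M * w ^ 2) ^ (1 / 2 : ℝ) = M ^ (1 / 2 : ℝ) * w := by
    rw [ENNReal.mul_rpow_of_nonneg _ _ (by norm_num), ← ENNReal.rpow_natCast, ← ENNReal.rpow_mul]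
    norm_num
  have hpow (x : ℝ≥0∞) : (x ^ 2) ^ (2 : ℝ) = x ^ 4 := by
    rw [ENNReal.rpow_ofNat, ← pow_mul]
  have h := ENNReal.lintegral_mul_le_Lp_mul_Lq P Real.HolderConjugate.two_two (hf.pow_const 2)
    (hg.pow_const 2)
  simp only [Pi.mul_apply, hpow, hfu, hgv, hsqrt] at h
  refine h.trans_eq ?_
  rw [mul_mul_mul_comm, ← ENNReal.rpow_add_of_nonneg _ _ (by norm_num) (by norm_num)]
  norm_num

theorem lintegral_enorm_pow_four_le {ι : Type*} [Countable ι] (b : HilbertBasis ι ℝ H)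
    {Z : Ω → H} {v : ι → ℝ≥0}
    (hZ : ∀ j, HasLaw (fun ω => inner ℝ (b j) (Z ω)) (gaussianReal 0 (v j)) P) :
    ∫⁻ ω, ‖Z ω‖ₑ ^ 4 ∂P ≤ 3 * (∑' j, (v j : ℝ≥0∞)) ^ 2 := by
  have hm (j : ι) : AEMeasurable (fun ω => ‖inner ℝ (b j) (Z ω)‖ₑ) P := (hZ j).aemeasurable.enorm
  have hdouble (a : ι → ℝ≥0∞) : (∑' j, a j) ^ 2 = ∑' j, ∑' k, a j * a k := by
    simp only [sq, ENNReal.tsum_mul_left, ENNReal.tsum_mul_right]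
  calc ∫⁻ ω, ‖Z ω‖ₑ ^ 4 ∂P
      = ∫⁻ ω, (∑' j, ‖inner ℝ (b j) (Z ω)‖ₑ ^ 2) ^ 2 ∂P := by
        simp only [tsum_enorm_inner_sq, ← pow_mul]
    _ = ∑' j, ∑' k, ∫⁻ ω, ‖inner ℝ (b j) (Z ω)‖ₑ ^ 2 * ‖inner ℝ (b k) (Z ω)‖ₑ ^ 2 ∂P := by
        have hmul (j k : ι) : AEMeasurable
            (fun ω => ‖inner ℝ (b j) (Z ω)‖ₑ ^ 2 * ‖inner ℝ (b k) (Z ω)‖ₑ ^ 2) P :=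
          ((hm j).pow_const 2).mul ((hm k).pow_const 2)
        simp only [hdouble]
        rw [lintegral_tsum fun j => AEMeasurable.tsum (hmul j)]
        exact tsum_congr fun j => lintegral_tsum (hmul j)
    _ ≤ ∑' j, ∑' k, 3 * ((v j : ℝ≥0∞) * v k) := by
        gcongr with j k
        exact lintegral_mul_sq_le_of_lintegral_pow_four (hm j) (hm k)
          (lintegral_enorm_pow_four_of_hasLaw_gaussianReal (hZ j))
          (lintegral_enorm_pow_four_of_hasLaw_gaussianReal (hZ k))
    _ = 3 * (∑' j, (v j : ℝ≥0∞)) ^ 2 := by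
        simp only [hdouble, ENNReal.tsum_mul_left]

end RandomVector

section ContinuousProcess

variable {T : ℝ≥0} {d : ℕ} {Ω : Type*} {mΩ : MeasurableSpace Ω} {P : Measure Ω}
  {Wdot : SpaceTimeL2 T d → Lp ℝ 2 P} {H : Type*} [NormedAddCommGroup H] [InnerProductSpace ℝ H]

theorem IsSpaceTimeWhiteNoise.lintegral_enorm_sub_pow_four_le (hW : IsSpaceTimeWhiteNoise P Wdot)
    {ι : Type*} [Countable ι] (b : HilbertBasis ι ℝ H) (A : H →L[ℝ] SpaceL2 d)
    {Z : Time T → Ω → H}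
    (hZ : ∀ t c, (fun ω => inner ℝ c (Z t ω)) =ᵐ[P] cylindricalWiener Wdot t (A c))
    (s t : Time T) :
    ∫⁻ ω, ‖Z s ω - Z t ω‖ₑ ^ 4 ∂P
      ≤ 3 * (∑' j, ‖A (b j)‖ₑ ^ 2) ^ 2 * edist ((s : ℝ≥0) : ℝ) ((t : ℝ≥0) : ℝ) ^ 2 := by
  wlog hst : s ≤ t generalizing s t
  · simpa only [enorm_sub_rev (Z s _), edist_comm ((s : ℝ≥0) : ℝ)]
      using this t s (le_of_not_ge hst)
  have hlaw (j : ι) : HasLaw (fun ω => inner ℝ (b j) (Z t ω - Z s ω))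
      (gaussianReal 0 (‖A (b j)‖₊ ^ 2 * ((t : ℝ≥0) - (s : ℝ≥0)))) P := by
    refine (hW.hasLaw_cylindricalWiener_sub hst (A (b j))).congr ?_
    filter_upwards [hZ s (b j), hZ t (b j), Lp.coeFn_sub (cylindricalWiener Wdot t (A (b j)))
      (cylindricalWiener Wdot s (A (b j)))] with ω hs ht hsub
    rw [hsub, Pi.sub_apply, ← hs, ← ht, inner_sub_right]
  have hdist : edist ((s : ℝ≥0) : ℝ) ((t : ℝ≥0) : ℝ) = ((t : ℝ≥0) - (s : ℝ≥0) : ℝ≥0) := by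
    rw [edist_comm, edist_dist, Real.dist_eq, ← NNReal.coe_sub hst, NNReal.abs_eq,
      ENNReal.ofReal_coe_nnreal]
  simp only [enorm_sub_rev (Z s _)]
  refine (lintegral_enorm_pow_four_le b hlaw).trans_eq ?_
  simp only [hdist, ENNReal.coe_mul, ENNReal.coe_pow, ENNReal.tsum_mul_right, mul_pow, mul_assoc,
    enorm_eq_nnnorm]

theorem IsSpaceTimeWhiteNoise.exists_continuous_process [CompleteSpace H]
    [TopologicalSpace.SeparableSpace H] (hW : IsSpaceTimeWhiteNoise P Wdot) {ι : Type*}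
    (b : HilbertBasis ι ℝ H) (A : H →L[ℝ] SpaceL2 d) (hA : ∑' j, ‖A (b j)‖ₑ ^ 2 ≠ ∞) :
    ∃ Y : Time T → Ω → H, (∀ t, StronglyMeasurable (Y t)) ∧ (∀ ω, Continuous fun t => Y t ω) ∧
      ∀ t c, (fun ω => inner ℝ c (Y t ω)) =ᵐ[P] cylindricalWiener Wdot t (A c) := by
  have := hW.gaussian.isProbabilityMeasure
  have : Countable ι := countable_of_orthonormal b.orthonormal
  have hsum (t : Time T) : Summable fun j => ‖(hW.wienerCLM t ∘L A) (b j)‖ ^ 2 := by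
    have hterm (j : ι) : ‖(hW.wienerCLM t ∘L A) (b j)‖ ^ 2
        = (t : ℝ≥0) * (‖A (b j)‖ₑ ^ 2).toReal := by
      rw [ContinuousLinearMap.comp_apply, hW.wienerCLM_apply, ← real_inner_self_eq_norm_sq,
        hW.inner_cylindricalWiener, min_self, real_inner_self_eq_norm_sq, ENNReal.toReal_pow,
        toReal_enorm]
    simpa only [hterm] using (ENNReal.summable_toReal hA).mul_left _
  choose Z hZ using fun t => exists_inner_eq_of_summable b (hW.wienerCLM t ∘L A) (hsum t)
  have hF (s : Time T) : |((s : ℝ≥0) : ℝ)| ≤ ⌈T⌉₊ := by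
    rw [NNReal.abs_eq]
    exact_mod_cast (show (s : ℝ≥0) ≤ T from s.2).trans (Nat.le_ceil T)
  have hmom (s t : Time T) : ∫⁻ ω, edist (Z s ω) (Z t ω) ^ (4 : ℝ) ∂P
      ≤ (3 * (∑' j, ‖A (b j)‖ₑ ^ 2).toNNReal ^ 2 : ℝ≥0)
        * edist ((s : ℝ≥0) : ℝ) ((t : ℝ≥0) : ℝ) ^ (2 : ℝ) := by
    simpa only [edist_eq_enorm_sub, ENNReal.rpow_ofNat, ENNReal.coe_mul, ENNReal.coe_pow,
      ENNReal.coe_toNNReal hA, ENNReal.coe_ofNat]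
      using hW.lintegral_enorm_sub_pow_four_le b A hZ s t
  obtain ⟨Y, hYm, hYZ, hYc⟩ := exists_modification_uniformContinuous hF
    (fun t => Lp.stronglyMeasurable (Z t)) (by norm_num) (by norm_num) hmom
  refine ⟨Y, hYm, fun ω => Metric.continuous_iff.2 fun t ε hε => ?_, fun t c => ?_⟩
  · obtain ⟨δ, hδ, h⟩ := hYc ω ε hε
    exact ⟨δ, hδ, fun s => h s t⟩
  · filter_upwards [hYZ t, hZ t c] with ω h1 h2
    rw [h1, h2]
    rfl

end ContinuousProcess

/-! ### Integrals of `L²`-valued functions -/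

section LpIntegral

variable {X Y : Type*} [MeasurableSpace X] [MeasurableSpace Y] {ν : Measure X} {μ : Measure Y}
  {F : X → Lp ℝ 2 μ} {K : X → Y → ℝ}

theorem integral_norm_coeFn_le (f : Lp ℝ 2 μ) {s : Set Y} (hs : MeasurableSet s) (hμs : μ s ≠ ∞) :
    ∫ y in s, ‖f y‖ ∂μ ≤ ‖f‖ * ‖indicatorConstLp 2 hs hμs (1 : ℝ)‖ := by
  calc ∫ y in s, ‖f y‖ ∂μ = ∫ y in s, |f| y ∂μ :=
        integral_congr_ae (ae_restrict_of_ae ((Lp.coeFn_abs f).mono fun y hy => hy.symm))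
    _ = inner ℝ (indicatorConstLp 2 hs hμs (1 : ℝ)) |f| :=
        (L2.inner_indicatorConstLp_one (𝕜 := ℝ) hs hμs _).symm
    _ ≤ ‖f‖ * ‖indicatorConstLp 2 hs hμs (1 : ℝ)‖ := by
        rw [mul_comm, ← norm_abs_eq_norm f]
        exact real_inner_le_norm _ _

theorem integrable_uncurry_of_integrable_Lp [SFinite ν] [SFinite μ] (hF : Integrable F ν)
    (hK : AEStronglyMeasurable (Function.uncurry K) (ν.prod μ)) (hFK : ∀ x, F x =ᵐ[μ] K x)
    {s : Set Y} (hs : MeasurableSet s) (hμs : μ s ≠ ∞) :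
    Integrable (Function.uncurry K) (ν.prod (μ.restrict s)) := by
  have hKs : AEStronglyMeasurable (Function.uncurry K) (ν.prod (μ.restrict s)) := by
    have h := hK.restrict (s := Set.univ ×ˢ s)
    rwa [← Measure.prod_restrict, Measure.restrict_univ] at h
  refine (integrable_prod_iff hKs).2 ⟨ae_of_all _ fun x =>
    (integrableOn_Lp_of_measure_ne_top (F x) (by norm_num) hμs).congr
      (ae_restrict_of_ae (hFK x)), ?_⟩
  refine (hF.norm.mul_const ‖indicatorConstLp 2 hs hμs (1 : ℝ)‖).mono'
    hKs.norm.integral_prod_right' (ae_of_all _ fun x => ?_)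
  rw [Real.norm_of_nonneg (integral_nonneg fun y => norm_nonneg _)]
  refine (integral_congr_ae (ae_restrict_of_ae ?_)).trans_le (integral_norm_coeFn_le (F x) hs hμs)
  filter_upwards [hFK x] with y hy
  rw [hy, Function.uncurry_apply_pair]

theorem coeFn_integral_Lp [SFinite ν] [SigmaFinite μ] (hF : Integrable F ν)
    (hK : AEStronglyMeasurable (Function.uncurry K) (ν.prod μ)) (hFK : ∀ x, F x =ᵐ[μ] K x) :
    (∫ x, F x ∂ν : Lp ℝ 2 μ) =ᵐ[μ] fun y => ∫ x, K x y ∂ν := by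
  refine ae_eq_of_forall_setIntegral_eq_of_sigmaFinite
    (fun s _ hμs => integrableOn_Lp_of_measure_ne_top _ (by norm_num) hμs.ne)
    (fun s hs hμs =>
      (integrable_uncurry_of_integrable_Lp hF hK hFK hs hμs.ne).integral_prod_right)
    fun s hs hμs => ?_
  calc ∫ y in s, (∫ x, F x ∂ν : Lp ℝ 2 μ) y ∂μ
      = ∫ x, inner ℝ (indicatorConstLp 2 hs hμs.ne (1 : ℝ)) (F x) ∂ν := by
        rw [integral_inner hF, L2.inner_indicatorConstLp_one]
    _ = ∫ x, ∫ y in s, K x y ∂μ ∂ν := by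
        refine integral_congr_ae (ae_of_all _ fun x => ?_)
        exact (L2.inner_indicatorConstLp_one (𝕜 := ℝ) hs hμs.ne _).trans
          (integral_congr_ae (ae_restrict_of_ae (hFK x)))
    _ = ∫ y in s, ∫ x, K x y ∂ν ∂μ :=
        integral_integral_swap (integrable_uncurry_of_integrable_Lp hF hK hFK hs hμs.ne)

theorem tendsto_toLp_of_dominated {ι : Type*} {l : Filter ι} [l.IsCountablyGenerated]
    {f : ι → Y → ℝ} {g bound : Y → ℝ} (hf : ∀ i, MemLp (f i) 2 μ) (hg : MemLp g 2 μ)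
    (hbound : MemLp bound 2 μ) (hle : ∀ᶠ i in l, ∀ y, ‖f i y - g y‖ ≤ bound y)
    (hlim : ∀ y, Tendsto (fun i => f i y) l (𝓝 (g y))) :
    Tendsto (fun i => (hf i).toLp (f i)) l (𝓝 (hg.toLp g)) := by
  have hnorm (i : ι) : ‖(hf i).toLp (f i) - hg.toLp g‖ ^ 2 = ∫ y, (f i y - g y) ^ 2 ∂μ := by
    rw [← MemLp.toLp_sub, norm_sq_eq_integral_sq]
    exact integral_congr_ae (((hf i).sub hg).coeFn_toLp.mono fun y hy => congrArg (· ^ 2) hy)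
  have hint : Tendsto (fun i => ∫ y, (f i y - g y) ^ 2 ∂μ) l (𝓝 (∫ _, (0 : ℝ) ∂μ)) := by
    refine tendsto_integral_filter_of_dominated_convergence (fun y => bound y ^ 2)
      (Eventually.of_forall fun i => ((hf i).1.sub hg.1).pow 2) ?_ hbound.integrable_sq
      (ae_of_all _ fun y => ?_)
    · filter_upwards [hle] with i hi
      refine ae_of_all _ fun y => ?_
      rw [norm_pow]
      exact pow_le_pow_left₀ (norm_nonneg _) (hi y) 2
    · simpa only [sub_self, ne_eq, OfNat.ofNat_ne_zero, not_false_eq_true, zero_pow]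
        using ((hlim y).sub_const (g y)).pow 2
  rw [tendsto_iff_norm_sub_tendsto_zero]
  simpa only [← hnorm, Real.sqrt_sq (norm_nonneg _), integral_zero, Real.sqrt_zero] using hint.sqrt

end LpIntegral

/-! ### Translations and mollification -/

section Mollify

variable {d : ℕ}

/-- Translation of an `L²` function, with the sign `shift y f = f (y + ·)`. -/
noncomputable def shift (y : Space d) : SpaceL2 d →ₗᵢ[ℝ] SpaceL2 d :=
  Lp.compMeasurePreservingₗᵢ ℝ (fun z => y + z) (measurePreserving_add_left volume y)

theorem coeFn_shift (y : Space d) (f : SpaceL2 d) : shift y f =ᵐ[volume] fun z => f (y + z) :=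
  Lp.coeFn_compMeasurePreserving f (measurePreserving_add_left volume y)

theorem shift_zero (f : SpaceL2 d) : shift 0 f = f := by
  apply Lp.ext
  filter_upwards [coeFn_shift 0 f] with z hz
  rw [hz, zero_add]

theorem continuous_shift (f : SpaceL2 d) : Continuous fun y => shift y f := by
  let add : C(Space d, C(Space d, Space d)) :=
    (ContinuousMap.mk (fun a : Space d × Space d => a.1 + a.2) continuous_add).curry
  exact (continuous_const (y := f)).compMeasurePreservingLp add.continuous
    (fun y => measurePreserving_add_left volume y) (by norm_num)

/-- The mollification `z ↦ ∫ r(y) f(y + z) dy` of `f` by a kernel `r`. For the symmetric kernels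
of interest this is the convolution of `f` with `r`. -/
noncomputable def mollify (r : Space d → ℝ) (f : SpaceL2 d) : SpaceL2 d :=
  ∫ y, r y • shift y f

theorem integrable_smul_shift {r : Space d → ℝ} (hr : Integrable r) (f : SpaceL2 d) :
    Integrable fun y => r y • shift y f :=
  hr.smul_bdd ‖f‖ (continuous_shift f).aestronglyMeasurable
    (ae_of_all _ fun y => ((shift y).norm_map f).le)

theorem mollify_sub {r : Space d → ℝ} (hr : Integrable r) (f g : SpaceL2 d) :
    mollify r (f - g) = mollify r f - mollify r g := by
  simp only [mollify, map_sub, smul_sub]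
  exact integral_sub (integrable_smul_shift hr f) (integrable_smul_shift hr g)

theorem sub_mollify {r s : Space d → ℝ} (hr : Integrable r) (hs : Integrable s) (f : SpaceL2 d) :
    mollify (r - s) f = mollify r f - mollify s f := by
  simp only [mollify, Pi.sub_apply, sub_smul]
  exact integral_sub (integrable_smul_shift hr f) (integrable_smul_shift hs f)

theorem norm_mollify_le (r : Space d → ℝ) (f : SpaceL2 d) :
    ‖mollify r f‖ ≤ (∫ y, ‖r y‖) * ‖f‖ := by
  refine (norm_integral_le_integral_norm _).trans_eq ?_
  simp only [norm_smul, LinearIsometry.norm_map, integral_mul_const]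

theorem tendsto_mollify {ι : Type*} {l : Filter ι} {r : Space d → ℝ} (hr : Integrable r)
    {u : ι → SpaceL2 d} {f : SpaceL2 d} (hu : Tendsto u l (𝓝 f)) :
    Tendsto (fun k => mollify r (u k)) l (𝓝 (mollify r f)) := by
  rw [tendsto_iff_norm_sub_tendsto_zero] at hu ⊢
  refine squeeze_zero (fun k => norm_nonneg _) (fun k => ?_)
    (by simpa only [mul_zero] using hu.const_mul (∫ y, ‖r y‖))
  rw [← mollify_sub hr]
  exact norm_mollify_le r _

theorem coeFn_mollify {r : Space d → ℝ} (hr : Integrable r) (hm : Measurable r) (f : SpaceL2 d) :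
    mollify r f =ᵐ[volume] fun z => ∫ x, f x * r (x - z) := by
  have hK : Measurable (Function.uncurry fun y z => r y * f (y + z)) :=
    (hm.comp measurable_fst).mul
      ((Lp.stronglyMeasurable f).measurable.comp (measurable_fst.add measurable_snd))
  have hF (y : Space d) : r y • shift y f =ᵐ[volume] fun z => r y * f (y + z) := by
    filter_upwards [coeFn_shift y f, Lp.coeFn_smul (r y) (shift y f)] with z h1 h2
    rw [h2, Pi.smul_apply, h1, smul_eq_mul]
  filter_upwards [coeFn_integral_Lp (integrable_smul_shift hr f) hK.aestronglyMeasurable hF]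
    with z hz
  rw [mollify, hz, ← integral_add_right_eq_self (fun x => f x * r (x - z)) z]
  simp only [add_sub_cancel_right, mul_comm]

end Mollify

namespace IsMollifierKernel

variable {d : ℕ} {ρ : Space d → ℝ}

theorem contDiff_mollifier (hρ : IsMollifierKernel ρ) (n : ℕ+) :
    ContDiff ℝ (⊤ : ℕ∞) (mollifier ρ n) :=
  contDiff_const.mul (hρ.smooth.comp (contDiff_const_smul (n : ℝ)))

theorem hasCompactSupport_mollifier (hρ : IsMollifierKernel ρ) (n : ℕ+) :
    HasCompactSupport (mollifier ρ n) :=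
  (hρ.compact_support.comp_homeomorph
    (Homeomorph.smulOfNeZero (n : ℝ) (Nat.cast_ne_zero.2 n.ne_zero))).mul_left

theorem integrable (hρ : IsMollifierKernel ρ) : Integrable ρ :=
  hρ.smooth.continuous.integrable_of_hasCompactSupport hρ.compact_support

theorem integrable_mollifier (hρ : IsMollifierKernel ρ) (n : ℕ+) : Integrable (mollifier ρ n) :=
  (hρ.contDiff_mollifier n).continuous.integrable_of_hasCompactSupport
    (hρ.hasCompactSupport_mollifier n)

theorem mollifier_neg (hρ : IsMollifierKernel ρ) (n : ℕ+) (x : Space d) :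
    mollifier ρ n (-x) = mollifier ρ n x := by
  rw [mollifier, mollifier, smul_neg, hρ.symm]

end IsMollifierKernel

section Mollifier

variable {d : ℕ} {ρ : Space d → ℝ}

theorem integral_mollifier_smul {E : Type*} [NormedAddCommGroup E] [NormedSpace ℝ E]
    (ρ : Space d → ℝ) (n : ℕ+) (g : Space d → E) :
    ∫ y, mollifier ρ n y • g y = ∫ u, ρ u • g ((n : ℝ)⁻¹ • u) := by
  have hn : (n : ℝ) ≠ 0 := Nat.cast_ne_zero.2 n.ne_zero
  have h := Measure.integral_comp_smul_of_nonneg (volume : Measure (Space d))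
    (fun u => ρ u • g ((n : ℝ)⁻¹ • u)) (n : ℝ) (hR := Nat.cast_nonneg _)
  simp only [inv_smul_smul₀ hn, finrank_euclideanSpace, Fintype.card_fin] at h
  simp only [mollifier, mul_smul, integral_smul, h]
  exact smul_inv_smul₀ (pow_ne_zero d hn) _

theorem IsMollifierKernel.norm_translate_sq (hρ : IsMollifierKernel ρ) (n : ℕ+) (x : Space d) :
    ‖hρ.translate n x‖₊ ^ 2 = (∫ y, ρ y ^ 2).toNNReal * (n : ℝ≥0) ^ d := by
  apply NNReal.eq
  rw [NNReal.coe_pow, coe_nnnorm, NNReal.coe_mul, NNReal.coe_pow, NNReal.coe_natCast,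
    Real.coe_toNNReal _ (integral_nonneg fun y => sq_nonneg _)]
  calc ‖hρ.translate n x‖ ^ 2 = ∫ y, mollifier ρ n (x - y) ^ 2 := by
        rw [norm_sq_eq_integral_sq]
        exact integral_congr_ae
          ((hρ.memLp_translate n x).coeFn_toLp.mono fun y hy => congrArg (· ^ 2) hy)
    _ = ∫ y, mollifier ρ n y • mollifier ρ n y := by
        rw [integral_sub_left_eq_self (fun u => mollifier ρ n u ^ 2)]
        simp only [sq, smul_eq_mul]
    _ = (∫ y, ρ y ^ 2) * (n : ℝ) ^ d := by
        rw [integral_mollifier_smul, ← integral_mul_const]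
        congr with u
        rw [mollifier, smul_inv_smul₀ (Nat.cast_ne_zero.2 n.ne_zero), smul_eq_mul]
        ring

theorem tendsto_inv_natCast_pnat : Tendsto (fun n : ℕ+ => (n : ℝ)⁻¹) atTop (𝓝 0) :=
  tendsto_inv_atTop_nhds_zero_nat.comp tendsto_PNat_val_atTop_atTop

theorem IsMollifierKernel.tendsto_mollify_mollifier (hρ : IsMollifierKernel ρ) (f : SpaceL2 d) :
    Tendsto (fun n : ℕ+ => mollify (mollifier ρ n) f) atTop (𝓝 f) := by
  have hf : ∫ u, ρ u • shift 0 f = f := by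
    rw [integral_smul_const, hρ.integral_eq_one, one_smul, shift_zero]
  simp only [mollify, integral_mollifier_smul]
  conv => rhs; rw [← hf]
  refine tendsto_integral_filter_of_dominated_convergence (fun u => ‖ρ u‖ * ‖f‖)
    (Eventually.of_forall fun n => ?_) (Eventually.of_forall fun n => ae_of_all _ fun u => ?_)
    (hρ.integrable.norm.mul_const _) (ae_of_all _ fun u => ?_)
  · exact (hρ.smooth.continuous.smul
      ((continuous_shift f).comp (continuous_const_smul _))).aestronglyMeasurable
  · rw [norm_smul, LinearIsometry.norm_map]
  · have hu : Tendsto (fun n : ℕ+ => (n : ℝ)⁻¹ • u) atTop (𝓝 0) := by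
      simpa only [zero_smul] using tendsto_inv_natCast_pnat.smul_const u
    exact (((continuous_shift f).tendsto 0).comp hu).const_smul _

end Mollifier

/-! ### The smoothing operator -/

section Smoothing

variable {d : ℕ}

/-- A positive continuous square integrable weight, which makes the smoothing operator
Hilbert–Schmidt. -/
noncomputable def weight (y : Space d) : ℝ := (1 + ‖y‖) ^ (-((d : ℝ) + 1))

theorem weight_pos (y : Space d) : 0 < weight y := Real.rpow_pos_of_pos (by positivity) _

theorem continuous_weight : Continuous (weight (d := d)) :=
  (continuous_const.add continuous_norm).rpow_const fun y =>
    Or.inl (add_pos_of_pos_of_nonneg one_pos (norm_nonneg y)).ne'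

theorem continuous_weight_inv : Continuous fun y : Space d => (weight y)⁻¹ :=
  continuous_weight.inv₀ fun y => (weight_pos y).ne'

theorem memLp_weight : MemLp (weight (d := d)) 2 volume := by
  refine (memLp_two_iff_integrable_sq continuous_weight.aestronglyMeasurable).2 ?_
  have hdim : (Module.finrank ℝ (Space d) : ℝ) < ((d : ℝ) + 1) * 2 := by
    rw [finrank_euclideanSpace_fin]
    linarith [Nat.cast_nonneg (α := ℝ) d]
  refine (integrable_one_add_norm hdim).congr (ae_of_all _ fun y => ?_)
  simp only [weight]
  rw [← Real.rpow_mul_natCast (by positivity), Nat.cast_ofNat, neg_mul]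

/-- The function `z ↦ weight y * expKernel (y - z)`, as a vector of `L²(ℝ^d)` depending on `y`. -/
noncomputable def smoothingVec (y : Space d) : SpaceL2 d :=
  weight y • Lp.compMeasurePreserving (fun z => y - z)
    (Measure.measurePreserving_sub_left volume y) (memLp_expKernel.toLp expKernel)

theorem coeFn_smoothingVec (y : Space d) :
    smoothingVec y =ᵐ[volume] fun z => weight y * expKernel (y - z) := by
  rw [smoothingVec, Lp.toLp_compMeasurePreserving, ← MemLp.toLp_const_smul]
  exact MemLp.coeFn_toLp _

theorem continuous_smoothingVec : Continuous (smoothingVec (d := d)) := by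
  let sub : C(Space d, C(Space d, Space d)) :=
    (ContinuousMap.mk (fun a : Space d × Space d => a.1 - a.2) continuous_sub).curry
  exact continuous_weight.smul ((continuous_const (y := memLp_expKernel.toLp expKernel)
    ).compMeasurePreservingLp sub.continuous (fun y => Measure.measurePreserving_sub_left volume y)
    (by norm_num))

theorem memLp_smoothingVec : MemLp (smoothingVec (d := d)) 2 volume := by
  refine memLp_weight.of_le_mul (c := ‖memLp_expKernel.toLp (expKernel (d := d))‖)
    continuous_smoothingVec.aestronglyMeasurable (ae_of_all _ fun y => ?_)
  rw [smoothingVec, norm_smul, Lp.norm_compMeasurePreserving, mul_comm]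

/-- The Hilbert–Schmidt operator `h ↦ ∫ weight y * expKernel (y - ·) * h y dy`. Its range contains
all smooth functions with compact support. -/
noncomputable def smoothingOp (d : ℕ) : SpaceL2 d →L[ℝ] SpaceL2 d :=
  integralOperator (memLp_smoothingVec.toLp smoothingVec)

theorem coeFn_smoothingOp_toLp {h : Space d → ℝ} (hm : Measurable h) (hh : MemLp h 2) :
    smoothingOp d (hh.toLp h)
      =ᵐ[volume] fun z => ∫ y, h y * (weight y * expKernel (y - z)) := by
  have hae : (fun y => hh.toLp h y • memLp_smoothingVec.toLp smoothingVec y)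
      =ᵐ[volume] fun y => h y • smoothingVec y := by
    filter_upwards [hh.coeFn_toLp, memLp_smoothingVec.coeFn_toLp] with y h1 h2
    rw [h1, h2]
  have hK : Measurable (Function.uncurry fun y z : Space d =>
      h y * (weight y * expKernel (y - z))) :=
    (hm.comp measurable_fst).mul ((continuous_weight.measurable.comp measurable_fst).mul
      (measurable_expKernel.comp (measurable_fst.sub measurable_snd)))
  rw [smoothingOp, integralOperator_apply, integral_congr_ae hae]
  refine coeFn_integral_Lp ((integrable_smul_of_Lp_two _ _).congr hae) hK.aestronglyMeasurable
    fun y => ?_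
  filter_upwards [Lp.coeFn_smul (h y) (smoothingVec y), coeFn_smoothingVec y] with z h1 h2
  rw [h1, Pi.smul_apply, h2, smul_eq_mul]

end Smoothing

/-! ### Preimages under the smoothing operator -/

section Field

variable {d : ℕ} {k : Space d → ℝ}

theorem memLp_weight_inv_mul_translate (hk : Continuous k) (hc : HasCompactSupport k)
    (x : Space d) : MemLp (fun y => (weight y)⁻¹ * k (x - y)) 2 volume :=
  (continuous_weight_inv.mul (by fun_prop)).memLp_of_hasCompactSupport
    ((hc.comp_homeomorph (Homeomorph.subLeft x)).mul_left)

/-- The function `y ↦ k (x - y) / weight y` as a vector of `L²(ℝ^d)`. The smoothing operator maps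
it to the translate `f (x - ·)` if `k` is `expKernelInv f`. -/
noncomputable def fieldVec (hk : Continuous k) (hc : HasCompactSupport k) (x : Space d) :
    SpaceL2 d :=
  (memLp_weight_inv_mul_translate hk hc x).toLp _

theorem coeFn_fieldVec (hk : Continuous k) (hc : HasCompactSupport k) (x : Space d) :
    fieldVec hk hc x =ᵐ[volume] fun y => (weight y)⁻¹ * k (x - y) :=
  (memLp_weight_inv_mul_translate hk hc x).coeFn_toLp

theorem continuous_fieldVec (hk : Continuous k) (hc : HasCompactSupport k) :
    Continuous (fieldVec hk hc) := by
  have hcont : Continuous fun p : Space d × Space d => (weight p.2)⁻¹ * k (p.1 - p.2) :=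
    (continuous_weight_inv.comp continuous_snd).mul (by fun_prop)
  refine continuous_iff_continuousAt.2 fun x₀ => ?_
  obtain ⟨R, hR⟩ := hc.isCompact.isBounded.subset_closedBall 0
  obtain ⟨M, hM⟩ := ((isCompact_closedBall x₀ 1).prod
    (isCompact_closedBall x₀ (R + 1))).exists_bound_of_continuousOn hcont.continuousOn
  have hsupp (x y : Space d) (hx : x ∈ Metric.closedBall x₀ 1)
      (hy : y ∉ Metric.closedBall x₀ (R + 1)) : k (x - y) = 0 := by
    refine image_eq_zero_of_notMem_tsupport fun hmem => hy ?_
    have hxy := mem_closedBall_zero_iff.1 (hR hmem)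
    rw [← dist_eq_norm, dist_comm] at hxy
    rw [Metric.mem_closedBall] at hx ⊢
    linarith [dist_triangle y x x₀]
  have hx₀ : x₀ ∈ Metric.closedBall x₀ 1 := Metric.mem_closedBall_self zero_le_one
  refine tendsto_toLp_of_dominated (memLp_weight_inv_mul_translate hk hc) _
    (memLp_indicator_const 2 measurableSet_closedBall (M + M)
      (Or.inr (measure_closedBall_lt_top (x := x₀) (r := R + 1)).ne)) ?_
    fun y => (hcont.comp (Continuous.prodMk_left y)).tendsto x₀
  filter_upwards [Metric.closedBall_mem_nhds x₀ one_pos] with x hx y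
  by_cases hy : y ∈ Metric.closedBall x₀ (R + 1)
  · rw [Set.indicator_of_mem hy]
    exact (norm_sub_le _ _).trans (add_le_add (hM (x, y) ⟨hx, hy⟩) (hM (x₀, y) ⟨hx₀, hy⟩))
  · rw [Set.indicator_of_notMem hy, hsupp x y hx hy, hsupp x₀ y hx₀ hy, sub_self, norm_zero]

theorem contDiff_inner_fieldVec (hk : ContDiff ℝ (⊤ : ℕ∞) k) (hc : HasCompactSupport k)
    (g : SpaceL2 d) :
    ContDiff ℝ (⊤ : ℕ∞) fun x => inner ℝ (fieldVec hk.continuous hc x) g := by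
  have hloc : LocallyIntegrable (fun y => (weight y)⁻¹ * g y) (volume : Measure (Space d)) := by
    rw [← locallyIntegrableOn_univ]
    exact (locallyIntegrableOn_univ.2 ((Lp.memLp g).locallyIntegrable (by norm_num))
      ).continuousOn_mul continuous_weight_inv.continuousOn isOpen_univ.isLocallyClosed
  convert hc.contDiff_convolution_right (ContinuousLinearMap.mul ℝ ℝ) hloc hk using 2 with x
  rw [inner_eq_integral_mul, convolution_def]
  refine integral_congr_ae ?_
  filter_upwards [coeFn_fieldVec hk.continuous hc x] with y hy
  rw [hy, ContinuousLinearMap.mul_apply']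
  ring

theorem integrableOn_smul_fieldVec (hk : Continuous k) (hc : HasCompactSupport k) (φ : SpaceL2 d)
    {B : Set (Space d)} (hB : Bornology.IsBounded B) :
    IntegrableOn (fun x => φ x • fieldVec hk hc x) B := by
  obtain ⟨R, hR⟩ := hB.subset_closedBall 0
  have hφ : IntegrableOn φ (Metric.closedBall (0 : Space d) R) :=
    integrableOn_Lp_of_measure_ne_top φ (by norm_num) measure_closedBall_lt_top.ne
  exact (hφ.smul_continuousOn (continuous_fieldVec hk hc).continuousOn
    (isCompact_closedBall _ _)).mono_set hR

variable {f : Space d → ℝ}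

theorem coeFn_smoothingOp_fieldVec (hf : ContDiff ℝ (⊤ : ℕ∞) f) (hc : HasCompactSupport f)
    (x : Space d) :
    smoothingOp d (fieldVec (contDiff_expKernelInv hf).continuous
      (hasCompactSupport_expKernelInv hc) x) =ᵐ[volume] fun z => f (x - z) := by
  have hk := (contDiff_expKernelInv hf).continuous
  have hm : Measurable fun y => (weight y)⁻¹ * expKernelInv f (x - y) :=
    (continuous_weight_inv.mul (by fun_prop)).measurable
  filter_upwards [coeFn_smoothingOp_toLp hm
    (memLp_weight_inv_mul_translate hk (hasCompactSupport_expKernelInv hc) x)] with z hz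
  rw [fieldVec, hz, ← integral_expKernel_mul_expKernelInv hf hc (x - z),
    ← integral_sub_right_eq_self (fun u => expKernel u * expKernelInv f (x - z - u)) z]
  congr with y
  have := (weight_pos y).ne'
  rw [show x - z - (y - z) = x - y by abel]
  field_simp

/-- The restriction of an `L²` function to a measurable set, extended by zero. -/
noncomputable def restrictLp (φ : SpaceL2 d) {B : Set (Space d)} (hB : MeasurableSet B) :
    SpaceL2 d :=
  ((Lp.memLp φ).indicator hB).toLp _

theorem coeFn_restrictLp (φ : SpaceL2 d) {B : Set (Space d)} (hB : MeasurableSet B) :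
    restrictLp φ hB =ᵐ[volume] B.indicator φ :=
  ((Lp.memLp φ).indicator hB).coeFn_toLp

theorem tendsto_restrictLp (φ : SpaceL2 d) {B : ℕ → Set (Space d)} (hmono : Monotone B)
    (hB : ∀ k, MeasurableSet (B k)) (hU : ⋃ k, B k = Set.univ) :
    Tendsto (fun k => restrictLp φ (hB k)) atTop (𝓝 φ) := by
  have h := tendsto_toLp_of_dominated (l := atTop) (fun k => (Lp.memLp φ).indicator (hB k))
    (Lp.memLp φ) (Lp.memLp φ).norm (Eventually.of_forall fun k y => ?_) fun y => ?_
  · rwa [Lp.toLp_coeFn] at h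
  · by_cases hy : y ∈ B k
    · rw [Set.indicator_of_mem hy, sub_self, norm_zero]
      exact norm_nonneg _
    · rw [Set.indicator_of_notMem hy, zero_sub, norm_neg]
  · simpa only [hU, Set.indicator_univ] using
      (hmono.tendsto_indicator B φ y).mono_right (pure_le_nhds _)

theorem smoothingOp_setIntegral_smul_fieldVec (hf : ContDiff ℝ (⊤ : ℕ∞) f)
    (hc : HasCompactSupport f) (φ : SpaceL2 d) {B : Set (Space d)} (hB : Bornology.IsBounded B)
    (hBm : MeasurableSet B) :
    smoothingOp d (∫ x in B, φ x • fieldVec (contDiff_expKernelInv hf).continuous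
      (hasCompactSupport_expKernelInv hc) x) = mollify f (restrictLp φ hBm) := by
  have hint := integrableOn_smul_fieldVec (contDiff_expKernelInv hf).continuous
    (hasCompactSupport_expKernelInv hc) φ hB
  have hK : Measurable (Function.uncurry fun x z : Space d => φ x * f (x - z)) :=
    ((Lp.stronglyMeasurable φ).measurable.comp measurable_fst).mul
      (hf.continuous.measurable.comp (measurable_fst.sub measurable_snd))
  have hF (x : Space d) : smoothingOp d (φ x • fieldVec (contDiff_expKernelInv hf).continuous
      (hasCompactSupport_expKernelInv hc) x) =ᵐ[volume] fun z => φ x * f (x - z) := by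
    rw [map_smul]
    filter_upwards [Lp.coeFn_smul (φ x) (smoothingOp d _), coeFn_smoothingOp_fieldVec hf hc x]
      with z h1 h2
    rw [h1, Pi.smul_apply, h2, smul_eq_mul]
  rw [← ContinuousLinearMap.integral_comp_comm _ hint]
  apply Lp.ext
  filter_upwards [coeFn_integral_Lp ((smoothingOp d).integrable_comp hint) hK.aestronglyMeasurable
    hF, coeFn_mollify (hf.continuous.integrable_of_hasCompactSupport hc) hf.continuous.measurable
      (restrictLp φ hBm)] with z h1 h2
  rw [h1, h2, ← integral_indicator hBm]
  refine integral_congr_ae ?_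
  filter_upwards [coeFn_restrictLp φ hBm] with x hx
  rw [hx, Set.indicator_mul_left]

end Field

/-! ### Fourier bounds for differences of mollifications -/

theorem integrable_of_tendsto_of_tendsto_integral {α ι : Type*} [MeasurableSpace α] {μ : Measure α}
    {l : Filter ι} [l.NeBot] [l.IsCountablyGenerated] {G : ι → α → ℝ} {f : α → ℝ} {M : ℝ}
    (hG : ∀ i, Integrable (G i) μ) (h0 : ∀ i x, 0 ≤ G i x)
    (hM : Tendsto (fun i => ∫ x, G i x ∂μ) l (𝓝 M))
    (hlim : ∀ x, Tendsto (fun i => G i x) l (𝓝 (f x))) : Integrable f μ := by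
  refine ⟨aestronglyMeasurable_of_tendsto_ae l (fun i => (hG i).1) (ae_of_all _ hlim), ?_⟩
  have hG_lintegral (i : ι) : ∫⁻ x, ‖G i x‖ₑ ∂μ = ENNReal.ofReal (∫ x, G i x ∂μ) := by
    rw [← ofReal_integral_norm_eq_lintegral_enorm (hG i)]
    simp only [Real.norm_of_nonneg (h0 i _)]
  calc ∫⁻ x, ‖f x‖ₑ ∂μ = ∫⁻ x, liminf (fun i => ‖G i x‖ₑ) l ∂μ :=
        lintegral_congr fun x => (hlim x).enorm.liminf_eq.symm
    _ ≤ liminf (fun i => ∫⁻ x, ‖G i x‖ₑ ∂μ) l := lintegral_liminf_le' fun i => (hG i).1.enorm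
    _ = ENNReal.ofReal M := by
        simp only [hG_lintegral]
        exact (ENNReal.tendsto_ofReal hM).liminf_eq
    _ < ∞ := ENNReal.ofReal_lt_top

section Fourier

open scoped FourierTransform SchwartzMap Convolution ContDiff

section Schwartz

variable {E F : Type*} [NormedAddCommGroup E] [NormedSpace ℝ E] [NormedAddCommGroup F]
  [NormedSpace ℝ F]

theorem exists_norm_fderiv_schwartzMap_le (h : 𝓢(E, F)) :
    ∃ C : ℝ, ∀ x, ‖fderiv ℝ h x‖ ≤ C / (1 + ‖x‖) ^ 2 := by
  refine ⟨2 ^ 2 * (Finset.Iic (2, 1)).sup (schwartzSeminormFamily ℝ E F) h, fun x =>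
    (le_div_iff₀' (by positivity)).2 ?_⟩
  rw [← norm_iteratedFDeriv_one]
  exact SchwartzMap.one_add_le_sup_seminorm_apply (𝕜 := ℝ) (m := (2, 1)) le_rfl le_rfl h x

theorem hasDerivAt_neg_inv_one_add_mul {r s : ℝ} (hs : 1 + s * r ≠ 0) :
    HasDerivAt (fun s => -(1 + s * r)⁻¹) (r / (1 + s * r) ^ 2) s := by
  have h := ((hasDerivAt_mul_const (x := s) r).const_add 1).fun_inv hs
  rw [neg_div] at h
  exact h.fun_neg.congr_deriv (neg_neg _)

theorem exists_norm_sub_smul_le (h : 𝓢(E, F)) :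
    ∃ C : ℝ, ∀ (ξ : E) (a b : ℝ), 0 ≤ a → a ≤ b →
      ‖h (b • ξ) - h (a • ξ)‖ ≤ C * ((1 + a * ‖ξ‖)⁻¹ - (1 + b * ‖ξ‖)⁻¹) := by
  obtain ⟨C, hC⟩ := exists_norm_fderiv_schwartzMap_le h
  refine ⟨C, fun ξ a b ha hab => ?_⟩
  have hpos {s : ℝ} (hs : a ≤ s) : 0 < 1 + s * ‖ξ‖ := by
    have := ha.trans hs
    positivity
  have hray (s : ℝ) : HasDerivAt (fun s : ℝ => h (s • ξ) - h (a • ξ))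
      (fderiv ℝ h (s • ξ) ξ) s := by
    have hsmul : HasDerivAt (fun s : ℝ => s • ξ) ξ s := by
      simpa only [one_smul, id] using (hasDerivAt_id s).smul_const ξ
    exact (h.differentiableAt.hasFDerivAt.comp_hasDerivAt s hsmul).sub_const _
  have hbound {s : ℝ} (hs : a ≤ s) :
      HasDerivAt (fun s : ℝ => C * ((1 + a * ‖ξ‖)⁻¹ + -(1 + s * ‖ξ‖)⁻¹))
        (C * (‖ξ‖ / (1 + s * ‖ξ‖) ^ 2)) s :=
    ((hasDerivAt_neg_inv_one_add_mul (hpos hs).ne').const_add _).const_mul C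
  simp only [sub_eq_add_neg (1 + a * ‖ξ‖)⁻¹]
  refine image_norm_le_of_norm_deriv_right_le_deriv_boundary'
    (fun s _ => (hray s).continuousAt.continuousWithinAt) (fun s _ => (hray s).hasDerivWithinAt)
    (by simp) (fun s hs => (hbound hs.1).continuousAt.continuousWithinAt)
    (fun s hs => (hbound hs.1).hasDerivWithinAt) (fun s hs => ?_) ⟨hab, le_rfl⟩
  calc ‖fderiv ℝ h (s • ξ) ξ‖ ≤ ‖fderiv ℝ h (s • ξ)‖ * ‖ξ‖ := ContinuousLinearMap.le_opNorm _ _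
    _ ≤ C / (1 + ‖s • ξ‖) ^ 2 * ‖ξ‖ := by gcongr; exact hC _
    _ = C * (‖ξ‖ / (1 + s * ‖ξ‖) ^ 2) := by
        rw [norm_smul, Real.norm_of_nonneg (ha.trans hs.1)]
        ring

end Schwartz

theorem exists_schwartzMap_fourier_convolution {E : Type*} [NormedAddCommGroup E]
    [InnerProductSpace ℝ E] [FiniteDimensional ℝ E] [MeasurableSpace E] [BorelSpace E]
    {g r : E → ℂ} (hg : Integrable g) (hgc : HasCompactSupport g) (hr : ContDiff ℝ ∞ r)
    (hrc : HasCompactSupport r) :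
    ∃ S : 𝓢(E, ℂ), (∀ x, S x = ∫ y, g y * r (x - y)) ∧ ∀ ξ, (𝓕 S) ξ = 𝓕 g ξ * 𝓕 r ξ := by
  have hsmooth : ContDiff ℝ ∞ (g ⋆[ContinuousLinearMap.mul ℝ ℂ, volume] r) :=
    HasCompactSupport.contDiff_convolution_right (n := ⊤) _ hrc hg.locallyIntegrable hr
  refine ⟨(HasCompactSupport.convolution _ hgc hrc).toSchwartzMap hsmooth, fun x => rfl,
    fun ξ => ?_⟩
  rw [SchwartzMap.fourier_coe]
  exact Real.fourier_mul_convolution_eq hg (hr.continuous.integrable_of_hasCompactSupport hrc) ξ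

variable {d : ℕ}

/-- The Fourier transform of a real function. -/
noncomputable def realFourier (f : Space d → ℝ) : Space d → ℂ :=
  𝓕 fun x => (f x : ℂ)

theorem realFourier_sub {f g : Space d → ℝ} (hf : Integrable f) (hg : Integrable g) :
    realFourier (f - g) = realFourier f - realFourier g := by
  ext ξ
  simp only [realFourier, Pi.sub_apply, Complex.ofReal_sub, Real.fourier_eq, smul_sub]
  exact integral_sub ((Real.fourierIntegral_convergent_iff ξ).2 hf.ofReal)
    ((Real.fourierIntegral_convergent_iff ξ).2 hg.ofReal)

theorem realFourier_zero (f : Space d → ℝ) : realFourier f 0 = ∫ x, f x := by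
  simp only [realFourier, Real.fourier_eq, inner_zero_right, neg_zero, AddChar.map_zero_eq_one,
    one_smul, integral_complex_ofReal]

theorem realFourier_mollifier (ρ : Space d → ℝ) (n : ℕ+) (ξ : Space d) :
    realFourier (mollifier ρ n) ξ = realFourier ρ ((n : ℝ)⁻¹ • ξ) := by
  have hswap (z : Circle) (c : ℝ) : z • (c : ℂ) = c • (z : ℂ) := by
    rw [Circle.smul_def, smul_eq_mul, Complex.real_smul, mul_comm]
  simp only [realFourier, Real.fourier_eq, hswap, integral_mollifier_smul, real_inner_smul_left,
    real_inner_smul_right]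

theorem exists_schwartzMap_eq_realFourier {f : Space d → ℝ} (hf : ContDiff ℝ ∞ f)
    (hc : HasCompactSupport f) : ∃ H : 𝓢(Space d, ℂ), ⇑H = realFourier f :=
  ⟨𝓕 ((hc.comp_left Complex.ofReal_zero).toSchwartzMap (Complex.ofRealCLM.contDiff.comp hf)),
    SchwartzMap.fourier_coe _⟩

section CompactSupport

variable {φ : SpaceL2 d} {K : Set (Space d)}

theorem exists_schwartzMap_ae_eq_mollify (hK : IsCompact K) (hφ : ∀ᵐ x, x ∉ K → φ x = 0)
    {r : Space d → ℝ} (hr : ContDiff ℝ ∞ r) (hrc : HasCompactSupport r)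
    (hsymm : ∀ x, r (-x) = r x) :
    ∃ S : 𝓢(Space d, ℂ), (∀ᵐ x, S x = (mollify r φ x : ℂ)) ∧
      ∀ ξ, (𝓕 S) ξ = realFourier φ ξ * realFourier r ξ := by
  have hφK : (K.indicator fun x => (φ x : ℂ)) =ᵐ[volume] fun x => (φ x : ℂ) := by
    filter_upwards [hφ] with x hx
    by_cases hxK : x ∈ K
    · rw [Set.indicator_of_mem hxK]
    · rw [Set.indicator_of_notMem hxK, hx hxK, Complex.ofReal_zero]
  have hint : Integrable (K.indicator fun x => (φ x : ℂ)) :=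
    (integrable_indicator_iff hK.measurableSet).2
      (integrableOn_Lp_of_measure_ne_top φ (by norm_num) hK.measure_lt_top.ne).ofReal
  obtain ⟨S, hS, hFS⟩ := exists_schwartzMap_fourier_convolution hint
    (HasCompactSupport.intro hK fun x hx => Set.indicator_of_notMem hx _)
    (Complex.ofRealCLM.contDiff.comp hr) (hrc.comp_left Complex.ofReal_zero)
  refine ⟨S, ?_, fun ξ => ?_⟩
  · filter_upwards [coeFn_mollify (hr.continuous.integrable_of_hasCompactSupport hrc)
      hr.continuous.measurable φ] with x hx
    rw [hS, hx, ← integral_complex_ofReal]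
    refine integral_congr_ae ?_
    filter_upwards [hφK] with y hy
    rw [hy, Complex.ofReal_mul, ← hsymm (y - x), neg_sub]
    rfl
  · rw [hFS, realFourier, realFourier, Real.fourier_congr_ae hφK]
    rfl

theorem integrable_norm_realFourier_sq_mul (hK : IsCompact K) (hφ : ∀ᵐ x, x ∉ K → φ x = 0)
    {r : Space d → ℝ} (hr : ContDiff ℝ ∞ r) (hrc : HasCompactSupport r)
    (hsymm : ∀ x, r (-x) = r x) :
    Integrable fun ξ => ‖realFourier φ ξ‖ ^ 2 * ‖realFourier r ξ‖ ^ 2 := by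
  obtain ⟨S, -, hS⟩ := exists_schwartzMap_ae_eq_mollify hK hφ hr hrc hsymm
  have hint : Integrable fun ξ => ‖(𝓕 S) ξ‖ ^ 2 := ((𝓕 S).memLp 2 volume).norm.integrable_sq
  simpa only [hS, norm_mul, mul_pow] using hint

theorem norm_mollify_sq_eq_integral (hK : IsCompact K) (hφ : ∀ᵐ x, x ∉ K → φ x = 0)
    {r : Space d → ℝ} (hr : ContDiff ℝ ∞ r) (hrc : HasCompactSupport r)
    (hsymm : ∀ x, r (-x) = r x) :
    ‖mollify r φ‖ ^ 2 = ∫ ξ, ‖realFourier φ ξ‖ ^ 2 * ‖realFourier r ξ‖ ^ 2 := by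
  obtain ⟨S, hSφ, hS⟩ := exists_schwartzMap_ae_eq_mollify hK hφ hr hrc hsymm
  calc ‖mollify r φ‖ ^ 2 = ∫ x, ‖S x‖ ^ 2 := by
        rw [norm_sq_eq_integral_sq]
        refine integral_congr_ae ?_
        filter_upwards [hSφ] with x hx
        rw [hx, Complex.norm_real, Real.norm_eq_abs, sq_abs]
    _ = ∫ ξ, ‖(𝓕 S) ξ‖ ^ 2 := (SchwartzMap.integral_norm_sq_fourier S).symm
    _ = ∫ ξ, ‖realFourier φ ξ‖ ^ 2 * ‖realFourier r ξ‖ ^ 2 := by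
        simp only [hS, norm_mul, mul_pow]

theorem IsMollifierKernel.integrable_norm_realFourier_sq {ρ : Space d → ℝ}
    (hρ : IsMollifierKernel ρ) (hK : IsCompact K) (hφ : ∀ᵐ x, x ∉ K → φ x = 0) :
    Integrable fun ξ => ‖realFourier φ ξ‖ ^ 2 := by
  obtain ⟨H, hH⟩ := exists_schwartzMap_eq_realFourier hρ.smooth hρ.compact_support
  have hmollify := (hρ.tendsto_mollify_mollifier φ).norm.pow 2
  simp only [norm_mollify_sq_eq_integral hK hφ (hρ.contDiff_mollifier _)
    (hρ.hasCompactSupport_mollifier _) (hρ.mollifier_neg _)] at hmollify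
  refine integrable_of_tendsto_of_tendsto_integral (fun n => integrable_norm_realFourier_sq_mul
    hK hφ (hρ.contDiff_mollifier n) (hρ.hasCompactSupport_mollifier n) (hρ.mollifier_neg n))
    (fun n ξ => by positivity) hmollify fun ξ => ?_
  have hξ : Tendsto (fun n : ℕ+ => (n : ℝ)⁻¹ • ξ) atTop (𝓝 0) := by
    simpa only [zero_smul] using tendsto_inv_natCast_pnat.smul_const ξ
  have hρξ := ((((H.continuous.tendsto 0).comp hξ).norm).pow 2).const_mul (‖realFourier φ ξ‖ ^ 2)
  simpa only [hH, realFourier_zero, hρ.integral_eq_one, Complex.ofReal_one, norm_one, one_pow,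
    mul_one, Function.comp_def, ← realFourier_mollifier] using hρξ

end CompactSupport

/-- The spectral energy `|𝓕 φ|²` of `φ` integrated against the weight `(1 + s |ξ|)⁻¹`. As a
function of the mollification scale `s` it is monotone, and its increments dominate the squared
distances between the mollifications of `φ`. -/
noncomputable def spectralClock (φ : Space d → ℝ) (s : ℝ) : ℝ :=
  ∫ ξ, ‖realFourier φ ξ‖ ^ 2 * (1 + s * ‖ξ‖)⁻¹

section SpectralClock

variable {φ : Space d → ℝ}

theorem inv_one_add_mul_norm_le_one {E : Type*} [SeminormedAddGroup E] {s : ℝ} (hs : 0 ≤ s)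
    (ξ : E) : (1 + s * ‖ξ‖)⁻¹ ≤ 1 :=
  inv_le_one_of_one_le₀ (le_add_of_nonneg_right (by positivity))

theorem integrable_spectralClock (hφ : Integrable fun ξ => ‖realFourier φ ξ‖ ^ 2) {s : ℝ}
    (hs : 0 ≤ s) : Integrable fun ξ => ‖realFourier φ ξ‖ ^ 2 * (1 + s * ‖ξ‖)⁻¹ := by
  refine hφ.mul_bdd (c := 1) (by fun_prop) (ae_of_all _ fun ξ => ?_)
  rw [Real.norm_of_nonneg (by positivity)]
  exact inv_one_add_mul_norm_le_one hs ξ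

theorem antitoneOn_spectralClock (hφ : Integrable fun ξ => ‖realFourier φ ξ‖ ^ 2) :
    AntitoneOn (spectralClock φ) (Set.Ici 0) := fun s (hs : 0 ≤ s) t (ht : 0 ≤ t) hst =>
  integral_mono (integrable_spectralClock hφ ht) (integrable_spectralClock hφ hs) fun ξ => by
    dsimp only
    gcongr

theorem sq_inv_sub_inv_le {E : Type*} [SeminormedAddGroup E] {s t : ℝ} (hs : 0 ≤ s) (hst : s ≤ t)
    (ξ : E) : ((1 + s * ‖ξ‖)⁻¹ - (1 + t * ‖ξ‖)⁻¹) ^ 2 ≤ (1 + s * ‖ξ‖)⁻¹ - (1 + t * ‖ξ‖)⁻¹ := by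
  have ht : 0 ≤ t := hs.trans hst
  have hle : (1 + t * ‖ξ‖)⁻¹ ≤ (1 + s * ‖ξ‖)⁻¹ := by gcongr
  have hpos : 0 ≤ (1 + t * ‖ξ‖)⁻¹ := by positivity
  exact pow_le_of_le_one (sub_nonneg.2 hle)
    (by linarith [inv_one_add_mul_norm_le_one hs ξ]) two_ne_zero

end SpectralClock

theorem inv_natCast_pnat_anti {m n : ℕ+} (hmn : m ≤ n) : (n : ℝ)⁻¹ ≤ (m : ℝ)⁻¹ :=
  inv_anti₀ (Nat.cast_pos.2 m.pos) (Nat.cast_le.2 hmn)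

theorem IsMollifierKernel.exists_norm_mollify_sub_sq_le {ρ : Space d → ℝ}
    (hρ : IsMollifierKernel ρ) {φ : SpaceL2 d} {K : Set (Space d)} (hK : IsCompact K)
    (hφ : ∀ᵐ x, x ∉ K → φ x = 0) :
    ∃ C : ℝ, ∀ m n : ℕ+, m ≤ n →
      ‖mollify (mollifier ρ n) φ - mollify (mollifier ρ m) φ‖ ^ 2 ≤
        C * (spectralClock φ (n : ℝ)⁻¹ - spectralClock φ (m : ℝ)⁻¹) := by
  obtain ⟨H, hH⟩ := exists_schwartzMap_eq_realFourier hρ.smooth hρ.compact_support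
  obtain ⟨C, hC⟩ := exists_norm_sub_smul_le H
  have hφ2 := hρ.integrable_norm_realFourier_sq hK hφ
  refine ⟨C ^ 2, fun m n hmn => ?_⟩
  have hle := inv_natCast_pnat_anti hmn
  have hn : 0 ≤ (n : ℝ)⁻¹ := by positivity
  have hclock_n := integrable_spectralClock hφ2 hn
  have hclock_m := integrable_spectralClock hφ2 (hn.trans hle)
  have hsmooth : ContDiff ℝ ∞ (mollifier ρ n - mollifier ρ m) :=
    (hρ.contDiff_mollifier n).sub (hρ.contDiff_mollifier m)
  have hsupp := (hρ.hasCompactSupport_mollifier n).sub (hρ.hasCompactSupport_mollifier m)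
  have hsymm (x : Space d) : (mollifier ρ n - mollifier ρ m) (-x)
      = (mollifier ρ n - mollifier ρ m) x := by
    simp only [Pi.sub_apply, hρ.mollifier_neg]
  have hfourier (ξ : Space d) : ‖realFourier (mollifier ρ n - mollifier ρ m) ξ‖ ^ 2 ≤
      C ^ 2 * ((1 + (n : ℝ)⁻¹ * ‖ξ‖)⁻¹ - (1 + (m : ℝ)⁻¹ * ‖ξ‖)⁻¹) := by
    rw [realFourier_sub (hρ.integrable_mollifier n) (hρ.integrable_mollifier m), Pi.sub_apply,
      realFourier_mollifier, realFourier_mollifier, ← hH, norm_sub_rev]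
    refine (pow_le_pow_left₀ (norm_nonneg _) (hC ξ _ _ hn hle) 2).trans ?_
    rw [mul_pow]
    gcongr
    exact sq_inv_sub_inv_le hn hle ξ
  rw [← sub_mollify (hρ.integrable_mollifier n) (hρ.integrable_mollifier m),
    norm_mollify_sq_eq_integral hK hφ hsmooth hsupp hsymm, spectralClock, spectralClock,
    ← integral_sub hclock_n hclock_m, ← integral_const_mul]
  refine integral_mono (integrable_norm_realFourier_sq_mul hK hφ hsmooth hsupp hsymm)
    ((hclock_n.sub hclock_m).const_mul _) fun ξ => ?_
  calc ‖realFourier φ ξ‖ ^ 2 * ‖realFourier (mollifier ρ n - mollifier ρ m) ξ‖ ^ 2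
      ≤ ‖realFourier φ ξ‖ ^ 2 *
        (C ^ 2 * ((1 + (n : ℝ)⁻¹ * ‖ξ‖)⁻¹ - (1 + (m : ℝ)⁻¹ * ‖ξ‖)⁻¹)) := by
        gcongr
        exact hfourier ξ
    _ = C ^ 2 * (‖realFourier φ ξ‖ ^ 2 * (1 + (n : ℝ)⁻¹ * ‖ξ‖)⁻¹
        - ‖realFourier φ ξ‖ ^ 2 * (1 + (m : ℝ)⁻¹ * ‖ξ‖)⁻¹) := by ring

theorem IsMollifierKernel.exists_nnnorm_mollify_sub_sq_le {ρ : Space d → ℝ}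
    (hρ : IsMollifierKernel ρ) {φ : SpaceL2 d} {K : Set (Space d)} (hK : IsCompact K)
    (hφ : ∀ᵐ x, x ∉ K → φ x = 0) :
    ∃ C : ℝ≥0, ∀ n m : ℕ+,
      ‖mollify (mollifier ρ n) φ - mollify (mollifier ρ m) φ‖₊ ^ 2 ≤
        C * nndist (spectralClock φ (n : ℝ)⁻¹) (spectralClock φ (m : ℝ)⁻¹) := by
  obtain ⟨C, hC⟩ := hρ.exists_norm_mollify_sub_sq_le hK hφ
  have hle {m n : ℕ+} (hmn : m ≤ n) :
      ‖mollify (mollifier ρ n) φ - mollify (mollifier ρ m) φ‖₊ ^ 2 ≤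
        ‖C‖₊ * nndist (spectralClock φ (n : ℝ)⁻¹) (spectralClock φ (m : ℝ)⁻¹) := by
    rw [nndist_eq_nnnorm, ← nnnorm_mul, ← NNReal.coe_le_coe]
    exact (hC m n hmn).trans (le_abs_self _)
  refine ⟨‖C‖₊, fun n m => (le_total m n).elim hle fun hnm => ?_⟩
  rw [← nnnorm_neg, neg_sub, nndist_comm]
  exact hle hnm

theorem exists_abs_spectralClock_inv_natCast_le {φ : Space d → ℝ}
    (hφ : Integrable fun ξ => ‖realFourier φ ξ‖ ^ 2) :
    ∃ R : ℕ, ∀ n : ℕ+, |spectralClock φ (n : ℝ)⁻¹| ≤ R := by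
  obtain ⟨R, hR⟩ := exists_nat_ge (spectralClock φ 0)
  refine ⟨R, fun n => ?_⟩
  have hn : 0 ≤ (n : ℝ)⁻¹ := by positivity
  rw [spectralClock, abs_of_nonneg (integral_nonneg fun ξ => by positivity)]
  exact (antitoneOn_spectralClock hφ Set.self_mem_Ici hn hn).trans hR

theorem cauchySeq_spectralClock_inv_natCast {φ : Space d → ℝ}
    (hφ : Integrable fun ξ => ‖realFourier φ ξ‖ ^ 2) :
    CauchySeq fun n : ℕ+ => spectralClock φ (n : ℝ)⁻¹ := by
  obtain ⟨R, hR⟩ := exists_abs_spectralClock_inv_natCast_le hφ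
  have hmono : Monotone fun n : ℕ+ => spectralClock φ (n : ℝ)⁻¹ := fun m n hmn =>
    antitoneOn_spectralClock hφ (Set.mem_Ici.2 (by positivity)) (Set.mem_Ici.2 (by positivity))
      (inv_natCast_pnat_anti hmn)
  exact (tendsto_atTop_ciSup hmono
    ⟨R, Set.forall_mem_range.2 fun n => (le_abs_self _).trans (hR n)⟩).cauchySeq

end Fourier

/-! ### Almost sure convergence -/

section Convergence

variable {Ω : Type*} {mΩ : MeasurableSpace Ω} {P : Measure Ω}

theorem ae_tendsto_of_tendsto_Lp_of_lintegral_edist_le [IsProbabilityMeasure P] {ι E : Type*}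
    [Countable ι] [Nonempty ι] [SemilatticeSup ι] [NormedAddCommGroup E] [CompleteSpace E]
    {r : ℝ≥0∞} [Fact (1 ≤ r)] {Z : ι → Lp E r P} {Z' : Lp E r P}
    (hZ : Tendsto Z atTop (𝓝 Z')) {F : ι → ℝ} {R : ℕ} (hFR : ∀ i, |F i| ≤ R)
    (hF : CauchySeq F) {p q : ℝ} (hp : 1 ≤ p) (hq : 1 < q) {M : ℝ≥0}
    (hmom : ∀ i j, ∫⁻ ω, edist (Z i ω) (Z j ω) ^ p ∂P ≤ M * edist (F i) (F j) ^ q) :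
    ∀ᵐ ω ∂P, Tendsto (fun i => Z i ω) atTop (𝓝 (Z' ω)) := by
  obtain ⟨Y, -, hYZ, hY⟩ := exists_modification_uniformContinuous hFR
    (fun i => Lp.stronglyMeasurable (Z i)) hp hq hmom
  obtain ⟨u, hu, hZu⟩ := (tendstoInMeasure_of_tendsto_Lp hZ).exists_seq_tendsto_ae'
  filter_upwards [hZu, ae_all_iff.2 hYZ] with ω hZω hYω
  have hcauchy : CauchySeq fun i => Y i ω := Metric.cauchySeq_iff.2 fun ε hε => by
    obtain ⟨δ, hδ, hYδ⟩ := hY ω ε hε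
    obtain ⟨N, hN⟩ := Metric.cauchySeq_iff.1 hF δ hδ
    exact ⟨N, fun i hi j hj => hYδ i j (hN i hi j hj)⟩
  obtain ⟨y, hy⟩ := cauchySeq_tendsto_of_complete hcauchy
  simp only [hYω] at hy
  rwa [tendsto_nhds_unique hZω (hy.comp hu)]

variable {T : ℝ≥0} {d : ℕ} {Wdot : SpaceTimeL2 T d → Lp ℝ 2 P} {ρ : Space d → ℝ}

theorem IsSpaceTimeWhiteNoise.lintegral_edist_cylindricalWiener_pow_four
    (hW : IsSpaceTimeWhiteNoise P Wdot) (t : Time T) (φ ψ : SpaceL2 d) :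
    ∫⁻ ω, edist (cylindricalWiener Wdot t φ ω) (cylindricalWiener Wdot t ψ ω) ^ 4 ∂P
      = 3 * (‖φ - ψ‖₊ ^ 2 * (t : ℝ≥0) : ℝ≥0) ^ 2 := by
  have hbot : ((⊥ : Time T) : ℝ≥0) = 0 := rfl
  have hlaw := hW.hasLaw_cylindricalWiener_sub (bot_le (a := t)) (φ - ψ)
  rw [hW.cylindricalWiener_bot, sub_zero, hbot, tsub_zero] at hlaw
  rw [← lintegral_enorm_pow_four_of_hasLaw_gaussianReal hlaw]
  refine lintegral_congr_ae ?_
  simp only [← hW.wienerCLM_apply, map_sub]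
  filter_upwards [Lp.coeFn_sub (hW.wienerCLM t φ) (hW.wienerCLM t ψ)] with ω hω
  rw [hω, Pi.sub_apply, edist_eq_enorm_sub]

theorem IsSpaceTimeWhiteNoise.tendsto_cylindricalWiener (hW : IsSpaceTimeWhiteNoise P Wdot)
    (t : Time T) {ι : Type*} {l : Filter ι} {u : ι → SpaceL2 d} {φ : SpaceL2 d}
    (hu : Tendsto u l (𝓝 φ)) :
    Tendsto (fun i => cylindricalWiener Wdot t (u i)) l (𝓝 (cylindricalWiener Wdot t φ)) :=
  ((hW.wienerCLM t).continuous.tendsto φ).comp hu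

theorem IsSpaceTimeWhiteNoise.ae_tendsto_cylindricalWiener_mollify
    (hW : IsSpaceTimeWhiteNoise P Wdot) (hρ : IsMollifierKernel ρ) (t : Time T) {φ : SpaceL2 d}
    {K : Set (Space d)} (hK : IsCompact K) (hφ : ∀ᵐ x, x ∉ K → φ x = 0) :
    ∀ᵐ ω ∂P, Tendsto (fun n : ℕ+ => cylindricalWiener Wdot t (mollify (mollifier ρ n) φ) ω) atTop
      (𝓝 (cylindricalWiener Wdot t φ ω)) := by
  have := hW.gaussian.isProbabilityMeasure
  have hφ2 := hρ.integrable_norm_realFourier_sq hK hφ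
  obtain ⟨R, hR⟩ := exists_abs_spectralClock_inv_natCast_le hφ2
  obtain ⟨C, hC⟩ := hρ.exists_nnnorm_mollify_sub_sq_le hK hφ
  refine ae_tendsto_of_tendsto_Lp_of_lintegral_edist_le
    (hW.tendsto_cylindricalWiener t (hρ.tendsto_mollify_mollifier φ)) hR
    (cauchySeq_spectralClock_inv_natCast hφ2) (p := 4) (q := 2) (by norm_num) (by norm_num)
    (M := 3 * (C * t) ^ 2) fun n m => ?_
  simp only [ENNReal.rpow_ofNat]
  rw [hW.lintegral_edist_cylindricalWiener_pow_four, edist_nndist]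
  norm_cast
  calc 3 * (‖mollify (mollifier ρ n) φ - mollify (mollifier ρ m) φ‖₊ ^ 2 * (t : ℝ≥0)) ^ 2
      ≤ 3 * (C * nndist (spectralClock φ (n : ℝ)⁻¹) (spectralClock φ (m : ℝ)⁻¹) * t) ^ 2 := by
        gcongr
        exact hC n m
    _ = 3 * (C * t) ^ 2
        * nndist (spectralClock φ (n : ℝ)⁻¹) (spectralClock φ (m : ℝ)⁻¹) ^ 2 := by ring

end Convergence

/-! ### The smoothed field -/

section SmoothField

variable {d : ℕ} {f : Space d → ℝ}

/-- The pairing of `y` with the preimage of `f (x - ·)` under the smoothing operator, as a function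
of `x`. It plays the role of the mollification of `h` by `f` where the distribution `h` is given
only through `y`, as `⟨h, smoothingOp d c⟩ = ⟨c, y⟩`. -/
noncomputable def smoothField (hf : ContDiff ℝ (⊤ : ℕ∞) f) (hc : HasCompactSupport f)
    (y : SpaceL2 d) (x : Space d) : ℝ :=
  inner ℝ (fieldVec (contDiff_expKernelInv hf).continuous (hasCompactSupport_expKernelInv hc) x) y

variable (hf : ContDiff ℝ (⊤ : ℕ∞) f) (hc : HasCompactSupport f) (φ : SpaceL2 d)
  {B : Set (Space d)}

theorem contDiff_smoothField (y : SpaceL2 d) : ContDiff ℝ (⊤ : ℕ∞) (smoothField hf hc y) :=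
  contDiff_inner_fieldVec (contDiff_expKernelInv hf) (hasCompactSupport_expKernelInv hc) y

theorem continuous_smoothField_left (x : Space d) : Continuous fun y => smoothField hf hc y x :=
  continuous_const.inner continuous_id

theorem integrableOn_mul_smoothField (y : SpaceL2 d) (hB : Bornology.IsBounded B) :
    IntegrableOn (fun x => φ x * smoothField hf hc y x) B :=
  ((integrableOn_smul_fieldVec _ _ φ hB).inner_const (𝕜 := ℝ) y).congr
    (ae_of_all _ fun _ => real_inner_smul_left _ _ _)

theorem setIntegral_mul_smoothField (y : SpaceL2 d) (hB : Bornology.IsBounded B) :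
    ∫ x in B, φ x * smoothField hf hc y x
      = inner ℝ (∫ x in B, φ x • fieldVec (contDiff_expKernelInv hf).continuous
          (hasCompactSupport_expKernelInv hc) x) y := by
  rw [real_inner_comm, ← integral_inner (integrableOn_smul_fieldVec _ _ φ hB)]
  refine integral_congr_ae (ae_of_all _ fun x => ?_)
  simp only [smoothField, real_inner_smul_right, real_inner_comm]

end SmoothField

section WienerField

variable {Ω : Type*} {mΩ : MeasurableSpace Ω} {P : Measure Ω} {T : ℝ≥0} {d : ℕ}
  {Wdot : SpaceTimeL2 T d → Lp ℝ 2 P} {t : Time T} {Y : Ω → SpaceL2 d} {f ρ : Space d → ℝ}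
  {φ : SpaceL2 d} {K : Set (Space d)}

theorem IsSpaceTimeWhiteNoise.exists_continuous_smoothingOp (hW : IsSpaceTimeWhiteNoise P Wdot) :
    ∃ Y : Time T → Ω → SpaceL2 d, (∀ t, StronglyMeasurable (Y t)) ∧
      (∀ ω, Continuous fun t => Y t ω) ∧
      ∀ t c, (fun ω => inner ℝ c (Y t ω)) =ᵐ[P] cylindricalWiener Wdot t (smoothingOp d c) := by
  have : Fact ((2 : ℝ≥0∞) ≠ ∞) := ⟨ENNReal.ofNat_ne_top⟩
  obtain ⟨_, b, -⟩ := exists_hilbertBasis ℝ (SpaceL2 d)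
  exact hW.exists_continuous_process b _ (tsum_enorm_integralOperator_sq_ne_top _ b)

theorem smoothField_mollifier_ae_eq (hρ : IsMollifierKernel ρ)
    (hY : ∀ c, (fun ω => inner ℝ c (Y ω)) =ᵐ[P] cylindricalWiener Wdot t (smoothingOp d c))
    (n : ℕ+) (x : Space d) :
    (fun ω => smoothField (hρ.contDiff_mollifier n) (hρ.hasCompactSupport_mollifier n) (Y ω) x)
      =ᵐ[P] mollifiedWiener Wdot hρ n t x := by
  have htrans : smoothingOp d (fieldVec _ _ x) = hρ.translate n x :=
    Lp.ext ((coeFn_smoothingOp_fieldVec (hρ.contDiff_mollifier n)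
      (hρ.hasCompactSupport_mollifier n) x).trans (hρ.memLp_translate n x).coeFn_toLp.symm)
  rw [mollifiedWiener, ← htrans]
  exact hY _

theorem IsSpaceTimeWhiteNoise.isBrownianMotion_smoothField (hW : IsSpaceTimeWhiteNoise P Wdot)
    (hρ : IsMollifierKernel ρ) {Y : Time T → Ω → SpaceL2 d} (hYm : ∀ t, StronglyMeasurable (Y t))
    (hYc : ∀ᵐ ω ∂P, Continuous fun t => Y t ω) (hY : ∀ t c,
      (fun ω => inner ℝ c (Y t ω)) =ᵐ[P] cylindricalWiener Wdot t (smoothingOp d c))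
    (n : ℕ+) (x : Space d) :
    IsBrownianMotion P (wienerFiltration P Wdot)
      ((∫ y, ρ y ^ 2).toNNReal * (n : ℝ≥0) ^ d) fun t ω =>
        smoothField (hρ.contDiff_mollifier n) (hρ.hasCompactSupport_mollifier n) (Y t ω) x := by
  rw [← hρ.norm_translate_sq n x]
  have hcont := continuous_smoothField_left (hρ.contDiff_mollifier n)
    (hρ.hasCompactSupport_mollifier n) x
  exact hW.isBrownianMotion (fun t => hcont.comp_stronglyMeasurable (hYm t))
    (fun t => smoothField_mollifier_ae_eq hρ (hY t) n x) (hYc.mono fun _ => hcont.comp)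

theorem setIntegral_mul_smoothField_ae_eq (hf : ContDiff ℝ (⊤ : ℕ∞) f) (hc : HasCompactSupport f)
    (hY : ∀ c, (fun ω => inner ℝ c (Y ω)) =ᵐ[P] cylindricalWiener Wdot t (smoothingOp d c))
    (φ : SpaceL2 d) {B : Set (Space d)} (hB : Bornology.IsBounded B) (hBm : MeasurableSet B) :
    (fun ω => ∫ x in B, φ x * smoothField hf hc (Y ω) x) =ᵐ[P]
      cylindricalWiener Wdot t (mollify f (restrictLp φ hBm)) := by
  simp only [setIntegral_mul_smoothField hf hc φ _ hB,
    ← smoothingOp_setIntegral_smul_fieldVec hf hc φ hB hBm]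
  exact hY _

theorem IsSpaceTimeWhiteNoise.isSpatialIntegral_smoothField (hW : IsSpaceTimeWhiteNoise P Wdot)
    (hf : ContDiff ℝ (⊤ : ℕ∞) f) (hc : HasCompactSupport f)
    (hY : ∀ c, (fun ω => inner ℝ c (Y ω)) =ᵐ[P] cylindricalWiener Wdot t (smoothingOp d c))
    (φ : SpaceL2 d) :
    IsSpatialIntegral P φ (fun x ω => smoothField hf hc (Y ω) x)
      (cylindricalWiener Wdot t (mollify f φ)) := by
  intro B hmono hBm hB hU
  have heq (j : ℕ) := setIntegral_mul_smoothField_ae_eq hf hc hY φ (hB j) (hBm j)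
  have htendsto := hW.tendsto_cylindricalWiener t (tendsto_mollify
    (hf.continuous.integrable_of_hasCompactSupport hc) (tendsto_restrictLp φ hmono hBm hU))
  rw [Lp.tendsto_Lp_iff_tendsto_eLpNorm'] at htendsto
  refine ⟨fun j => ae_of_all _ fun ω => integrableOn_mul_smoothField hf hc φ (Y ω) (hB j),
    fun j => (Lp.memLp _).ae_eq (heq j).symm, htendsto.congr fun j => eLpNorm_congr_ae ?_⟩
  filter_upwards [heq j] with ω hω
  rw [hω, Pi.sub_apply]

theorem integrable_mul_smoothField (hf : ContDiff ℝ (⊤ : ℕ∞) f) (hc : HasCompactSupport f)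
    (hK : IsCompact K) (hφ : ∀ᵐ x, x ∉ K → φ x = 0) (y : SpaceL2 d) :
    Integrable fun x => φ x * smoothField hf hc y x := by
  refine (integrableOn_mul_smoothField hf hc φ y hK.isBounded).integrable_of_ae_notMem_eq_zero ?_
  filter_upwards [hφ] with x hx hxK
  rw [hx hxK, zero_mul]

theorem restrictLp_eq_self (hK : MeasurableSet K) (hφ : ∀ᵐ x, x ∉ K → φ x = 0) :
    restrictLp φ hK = φ :=
  Lp.ext ((coeFn_restrictLp φ hK).trans
    (indicator_ae_eq_of_restrict_compl_ae_eq_zero hK ((ae_restrict_iff' hK.compl).2 hφ)))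

theorem integral_mul_smoothField_ae_eq (hf : ContDiff ℝ (⊤ : ℕ∞) f) (hc : HasCompactSupport f)
    (hY : ∀ c, (fun ω => inner ℝ c (Y ω)) =ᵐ[P] cylindricalWiener Wdot t (smoothingOp d c))
    (hK : IsCompact K) (hφ : ∀ᵐ x, x ∉ K → φ x = 0) :
    (fun ω => ∫ x, φ x * smoothField hf hc (Y ω) x) =ᵐ[P]
      cylindricalWiener Wdot t (mollify f φ) := by
  have hset (ω : Ω) : ∫ x in K, φ x * smoothField hf hc (Y ω) x
      = ∫ x, φ x * smoothField hf hc (Y ω) x := by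
    refine setIntegral_eq_integral_of_ae_compl_eq_zero ?_
    filter_upwards [hφ] with x hx hxK
    rw [hx hxK, zero_mul]
  simpa only [hset, restrictLp_eq_self hK.measurableSet hφ] using
    setIntegral_mul_smoothField_ae_eq hf hc hY φ hK.isBounded hK.measurableSet

end WienerField

end CylWiener

theorem mainTheorem3 {Ω : Type*} {mΩ : MeasurableSpace Ω} (P : Measure Ω) [IsProbabilityMeasure P]
    (T : ℝ≥0) (hT : 0 < T) (d : ℕ)
    (Wdot : SpaceTimeL2 T d → Lp ℝ 2 P) (hW : IsSpaceTimeWhiteNoise P Wdot)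
    (ρ : Space d → ℝ) (hρ : IsMollifierKernel ρ) :
    ∃ (ℱ : Filtration (Time T) mΩ) (X : ℕ+ → Time T → Space d → Ω → ℝ),
      -- `X` is a version of the mollified cylindrical Wiener processes
      (∀ n t x, X n t x =ᵐ[P] mollifiedWiener Wdot hρ n t x) ∧
      IsGoodWeakApproximation ℱ (cylindricalWiener Wdot) X ∧
      (∀ (n : ℕ+) x, IsBrownianMotionWithQV P ℱ ((∫ y, ρ y ^ 2).toNNReal * (n : ℝ≥0) ^ d)
        fun t => X n t x) ∧
      ∀ (t : Time T) (φ : SpaceL2 d),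
        (∃ K : Set (Space d), IsCompact K ∧ ∀ᵐ x, x ∉ K → φ x = 0) →
        (∀ n, ∀ᵐ ω ∂P, Integrable fun x => φ x * X n t x ω) ∧
        ∀ᵐ ω ∂P, Tendsto (fun n => ∫ x, φ x * X n t x ω) atTop
          (𝓝 (cylindricalWiener Wdot t φ ω)) := by
  have hf := hρ.contDiff_mollifier
  have hc := hρ.hasCompactSupport_mollifier
  obtain ⟨Y, hYm, hYc, hY⟩ := hW.exists_continuous_smoothingOp
  have hB := hW.isBrownianMotion_smoothField hρ hYm (ae_of_all P hYc) hY
  have hQ (n : ℕ+) (x : Space d) : IsBrownianMotionWithQV P (wienerFiltration P Wdot) _ _ :=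
    ⟨hB n x, (hB n x).hasQuadraticVariation⟩
  have hS (n : ℕ+) : IsSmoothSemimartingale P (wienerFiltration P Wdot) fun t x ω =>
      smoothField (hf n) (hc n) (Y t ω) x :=
    ⟨fun x => (hB n x).isSemimartingale, ae_of_all P fun ω =>
      ⟨fun t => contDiff_smoothField (hf n) (hc n) (Y t ω),
        fun x => (continuous_smoothField_left (hf n) (hc n) x).comp (hYc ω)⟩⟩
  refine ⟨wienerFiltration P Wdot, fun n t x ω => smoothField (hf n) (hc n) (Y t ω) x,
    fun n t x => smoothField_mollifier_ae_eq hρ (hY t) n x, ⟨⟨hS, fun φ t => ⟨_, fun n =>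
      hW.isSpatialIntegral_smoothField (hf n) (hc n) (hY t) φ,
      hW.tendsto_cylindricalWiener t (hρ.tendsto_mollify_mollifier φ)⟩⟩, _, hQ⟩, hQ, ?_⟩
  rintro t φ ⟨K, hK, hφ⟩
  refine ⟨fun n => ae_of_all P fun ω => integrable_mul_smoothField (hf n) (hc n) hK hφ (Y t ω), ?_⟩
  filter_upwards [hW.ae_tendsto_cylindricalWiener_mollify hρ t hK hφ, ae_all_iff.2 fun n : ℕ+ =>
    integral_mul_smoothField_ae_eq (hf n) (hc n) (hY t) hK hφ] with ω hlim hint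
  exact hlim.congr fun n => (hint n).symm
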